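/- Let $\ell\in\mathbb Z$ satisfy $\ell\equiv 4 \pmod{27}$, $\ell\equiv 1\pmod{35}$, $\ell\not\equiv 0,-1\pmod{37}$, and suppose that every prime divisor of $2\ell+1$ is congruent to $1$, $-1$ or $3$ modulo $8$. Put $k=\ell(\ell+1)$, let $\mathcal U_k$ be the affine scheme over $\mathbb Z$ defined by $$x^2+y^2+z^2+4(x^2y^2+y^2z^2+z^2x^2)-16x^2y^2z^2=k,$$ let $U_k=\mathcal U_k\times_{\mathbb Z}\mathbb Q$, and let $\mathcal U_k(\mathbf A_{\mathbb Z})=U_k(\mathbb R)\times\prod_p\mathcal U_k(\mathbb Z_p)$. Suppose that $\ell\equiv 5$ or $\ell\equiv 3\pmod 8$. Then the quaternion classes $\mathcal A_1=(4x^2+1,\,2(4k+1))$ and $\mathcal A_2=(4y^2+1,\,2(4k+1))$ extend to classes in $\mathrm{Br}_1\,U_k=\mathrm{Ker}(\mathrm{Br}\,U_k\to\mathrm{Br}\,(U_k)_{\overline{\mathbb Q}})$ killed by $2$, whose local invariants vanish at every point of $U_k(\mathbb R)$ and at every point of $\mathcal U_k(\mathbb Z_p)$ for every prime $p\ne 2$.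 Write $\mathcal U_k(\mathbf A_{\mathbb Z})^{\mathcal A}$ for the set of points $(P_v)_v$ of $\mathcal U_k(\mathbf A_{\mathbb Z})$ with $\sum_v \mathrm{inv}_v\,\mathcal A_i(P_v)=0$ for $i=1,2$, that is, those orthogonal to the subgroup $\mathcal A$ generated by $\mathcal A_1,\mathcal A_2$. (a) If $\ell\equiv 5\pmod 8$, then there is a Brauer–Manin obstruction to the integral Hasse principle on $\mathcal U_k$ with respect to $\mathcal A$, coming only from $p=2$: one has $\mathcal U_k(\mathbf A_{\mathbb Z})\neq\emptyset$ and $\mathcal U_k(\mathbb Z)=\mathcal U_k(\mathbf A_{\mathbb Z})^{\mathcal A}=\emptyset$, and at every point $P$ of $\mathcal U_k(\mathbb Z_2)$ at least one of $\mathrm{inv}_2\,\mathcal A_1(P)$, $\mathrm{inv}_2\,\mathcal A_2(P)$ is nonzero. (b) If $\ell\equiv 3\pmod 8$, then $\mathcal A$ gives no obstruction: $\mathcal U_k(\mathbf A_{\mathbb Z})^{\mathcal A}=\mathcal U_k(\mathbf A_{\mathbb Z})$; moreover this set is nonempty if and only if $\ell\not\equiv 19\pmod{32}$. -/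

import Mathlib

open scoped TensorProduct Quaternion

noncomputable section

namespace MarkoffK3

/-! ### Brauer classes, represented by Azumaya algebras -/

/-- An Azumaya algebra over a commutative ring `R`; it represents an element of the Brauer group
of `R`. -/
structure AzumayaAlgebra (R : Type) [CommRing R] where
  carrier : Type
  [ring : Ring carrier]
  [algebra : Algebra R carrier]
  [isAzumaya : IsAzumaya R carrier]

attribute [instance] AzumayaAlgebra.ring AzumayaAlgebra.algebra AzumayaAlgebra.isAzumaya

/-- `A` and `B` are Brauer equivalent over the commutative ring `R`:
`A ⊗ End P ≅ B ⊗ End Q` for finitely generated projective faithful modules `P`, `Q`. -/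
def BrauerEquivalent (R : Type) [CommRing R] (A B : Type) [Ring A] [Algebra R A]
    [Ring B] [Algebra R B] : Prop :=
  ∃ (P Q : Type) (_ : AddCommGroup P) (_ : Module R P) (_ : AddCommGroup Q) (_ : Module R Q),
    Module.Finite R P ∧ Module.Projective R P ∧ FaithfulSMul R P ∧
    Module.Finite R Q ∧ Module.Projective R Q ∧ FaithfulSMul R Q ∧
    Nonempty ((A ⊗[R] Module.End R P) ≃ₐ[R] (B ⊗[R] Module.End R Q))

/-- `A` has trivial Brauer class over the commutative ring `R`: it is isomorphic to `End P` for a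
finitely generated projective faithful module `P`.  Over a field: `A` is a matrix algebra. -/
def BrauerTrivial (R : Type) [CommRing R] (A : Type) [Ring A] [Algebra R A] : Prop :=
  ∃ (P : Type) (_ : AddCommGroup P) (_ : Module R P),
    Module.Finite R P ∧ Module.Projective R P ∧ FaithfulSMul R P ∧
    Nonempty (A ≃ₐ[R] Module.End R P)

/-- The pullback of the `R`-algebra `A` along the ring homomorphism `φ : R → S` has trivial
Brauer class. -/
def SplitBy {R S : Type} [CommRing R] [CommRing S] (φ : R →+* S)
    (A : Type) [Ring A] [Algebra R A] : Prop :=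
  letI : Algebra R S := φ.toAlgebra
  BrauerTrivial S (S ⊗[R] A)

/-! ### The surfaces -/

/-- `x² + y² + z² + 4 (x²y² + y²z² + z²x²) - 16 x²y²z²`. -/
def F₃ {A : Type} [CommRing A] (x y z : A) : A :=
  x ^ 2 + y ^ 2 + z ^ 2 + 4 * (x ^ 2 * y ^ 2 + y ^ 2 * z ^ 2 + z ^ 2 * x ^ 2)
    - 16 * x ^ 2 * y ^ 2 * z ^ 2

/-- The set `𝒰_k(A)` of `A`-points of the affine scheme over `ℤ` with equation
`F₃(x, y, z) = k`. -/
def Points (k : ℤ) (A : Type) [CommRing A] : Type :=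
  {v : Fin 3 → A // F₃ (v 0) (v 1) (v 2) = (k : A)}

/-- Functoriality of `A ↦ 𝒰_k(A)`. -/
def Points.map {k : ℤ} {A B : Type} [CommRing A] [CommRing B] (φ : A →+* B)
    (P : Points k A) : Points k B :=
  ⟨fun i => φ (P.1 i), by
    have h := congrArg φ P.2
    have h4 : φ 4 = 4 := map_ofNat φ 4
    have h16 : φ 16 = 16 := map_ofNat φ 16
    simpa [F₃, h4, h16] using h⟩

/-- The polynomial `F₃ - k` over `ℚ`. -/
def poly (k : ℤ) : MvPolynomial (Fin 3) ℚ :=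
  F₃ (MvPolynomial.X 0) (MvPolynomial.X 1) (MvPolynomial.X 2) - MvPolynomial.C (k : ℚ)

/-- The coordinate ring `ℚ[U_k]` of the affine surface `U_k : F₃(x, y, z) = k` over `ℚ`. -/
abbrev CoordRing (k : ℤ) : Type :=
  MvPolynomial (Fin 3) ℚ ⧸ Ideal.span {poly k}

/-- The coordinate functions `x, y, z` on `U_k`, for `i = 0, 1, 2`. -/
def coord (k : ℤ) (i : Fin 3) : CoordRing k :=
  Ideal.Quotient.mk _ (MvPolynomial.X i)

/-- Evaluation of functions on `U_k` at a point with values in a `ℚ`-algebra. -/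
def evalAt {k : ℤ} {A : Type} [CommRing A] [Algebra ℚ A] (P : Points k A) :
    CoordRing k →ₐ[ℚ] A :=
  Ideal.Quotient.liftₐ _ (MvPolynomial.aeval P.1) (by
    intro a ha
    have hle : Ideal.span {poly k} ≤ RingHom.ker (MvPolynomial.aeval P.1 : _ →ₐ[ℚ] A) := by
      rw [Ideal.span_singleton_le_iff_mem, RingHom.mem_ker]
      have h := P.2
      simp only [F₃] at h
      simp [poly, F₃, h]
    exact hle ha)

/-! ### The quaternion classes -/

/-- The function `4 xᵢ² + 1` on `U_k`. -/
def quadFun (k : ℤ) (i : Fin 3) : CoordRing k := 4 * coord k i ^ 2 + 1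

/-- The Azumaya algebra `𝒜` on `U_k` represents the class `(4 xᵢ² + 1, 2(4k+1))`: on the open
subscheme `4 xᵢ² + 1 ≠ 0` of `U_k` it is Brauer equivalent to the quaternion algebra
`(4 xᵢ² + 1, 2(4k+1))`, with generators `i² = 4 xᵢ² + 1`, `j² = 2(4k+1)`, `ij = -ji`. -/
def RepresentsQuaternionClass (k : ℤ) (i : Fin 3) (𝒜 : AzumayaAlgebra (CoordRing k)) : Prop :=
  BrauerEquivalent (Localization.Away (quadFun k i))
    (Localization.Away (quadFun k i) ⊗[CoordRing k] 𝒜.carrier)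
    ℍ[Localization.Away (quadFun k i),
      algebraMap (CoordRing k) (Localization.Away (quadFun k i)) (quadFun k i),
      algebraMap ℤ (Localization.Away (quadFun k i)) (2 * (4 * k + 1))]

/-- The Brauer class of `𝒜` is algebraic: it becomes trivial on `U_k × ℚ̄`. -/
def IsAlgebraic (k : ℤ) (𝒜 : AzumayaAlgebra (CoordRing k)) : Prop :=
  SplitBy (R := CoordRing k) (S := AlgebraicClosure ℚ ⊗[ℚ] CoordRing k)
    (Algebra.TensorProduct.includeRight :
      CoordRing k →ₐ[ℚ] AlgebraicClosure ℚ ⊗[ℚ] CoordRing k).toRingHom 𝒜.carrier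

/-- The Brauer class of `𝒜` is killed by `2`. -/
def IsTwoTorsion {R : Type} [CommRing R] (𝒜 : AzumayaAlgebra R) : Prop :=
  BrauerTrivial R (𝒜.carrier ⊗[R] 𝒜.carrier)

/-! ### Local invariants and the Brauer–Manin set -/

open Classical in
/-- The local invariant in `ℚ/ℤ` of the pullback along `φ : R → K` of a Brauer class killed by `2`,
where `K = ℚ_p` or `K = ℝ`.  As the invariant map of `K` identifies `Br(K)[2]` with
`{0, 1/2} ⊆ ℚ/ℤ`, it is `0` if the pullback is split and `1/2` otherwise.
It is only meant for classes that are killed by `2`. -/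
def localInv {R K : Type} [CommRing R] [Field K] (φ : R →+* K) (𝒜 : AzumayaAlgebra R) :
    AddCircle (1 : ℚ) :=
  if SplitBy φ 𝒜.carrier then 0 else ((1 / 2 : ℚ) : AddCircle (1 : ℚ))

/-- `inv_p 𝒜(P)` for `P ∈ 𝒰_k(ℤ_p)`. -/
def padicInv {k : ℤ} (𝒜 : AzumayaAlgebra (CoordRing k)) (p : ℕ) [Fact p.Prime]
    (P : Points k ℤ_[p]) : AddCircle (1 : ℚ) :=
  localInv (evalAt (P.map (PadicInt.Coe.ringHom (p := p)))).toRingHom 𝒜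

/-- `inv_∞ 𝒜(P)` for `P ∈ U_k(ℝ)`. -/
def realInv {k : ℤ} (𝒜 : AzumayaAlgebra (CoordRing k)) (P : Points k ℝ) : AddCircle (1 : ℚ) :=
  localInv (evalAt P).toRingHom 𝒜

instance (p : Nat.Primes) : Fact (p : ℕ).Prime := ⟨p.2⟩

/-- The integral adelic points `𝒰_k(𝐀_ℤ) = U_k(ℝ) × ∏_p 𝒰_k(ℤ_p)`. -/
abbrev AdelicPoints (k : ℤ) : Type :=
  Points k ℝ × ((p : Nat.Primes) → Points k ℤ_[(p : ℕ)])

/-- The Brauer–Manin pairing `∑_v inv_v 𝒜(P_v)`, for a class killed by `2`. -/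
def pairing {k : ℤ} (𝒜 : AzumayaAlgebra (CoordRing k)) (P : AdelicPoints k) :
    AddCircle (1 : ℚ) :=
  realInv 𝒜 P.1 + ∑ᶠ p : Nat.Primes, padicInv 𝒜 (p : ℕ) (P.2 p)

/-- The set `𝒰_k(𝐀_ℤ)^B` of adelic points that are orthogonal to a set `B` of Brauer classes
killed by `2`.  As the pairing is additive in the Brauer class, this is also the set of points
orthogonal to the subgroup generated by `B`. -/
def brauerManinSet (k : ℤ) (B : Set (AzumayaAlgebra (CoordRing k))) : Set (AdelicPoints k) :=
  {P | ∀ 𝒜 ∈ B, pairing 𝒜 P = 0}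

end MarkoffK3

end

/-! Put `m = 2ℓ + 1`, so that `4k + 1 = m²`. The equation of the surface reads
`(4x²+1)(4y²+1)(4z²+1) = m² + 2(8xyz)²`.

Extension: with `t = 8yz` and a polynomial `b`, one has `t² - (4x²+1)b = 2(4k+1)` on `U_k`. The
Clifford algebra of the binary form `(4x²+1)X² + 2tXY + bY²` therefore has constant nonzero
discriminant `8(4k+1)`. It is Azumaya on all of `U_k`, and where `4x²+1` is invertible it is the
quaternion algebra `(4x²+1, 2(4k+1))`.

Places other than 2: since `4k+1` is a square, the class at a point is `(4x²+1, 2)`. It splits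
wherever 2 is a square, hence over `ℝ` and for `p ≡ ±1 mod 8`. For `p ≡ 3, 5 mod 8` the value
`4x²+1` is a unit (`quad_ne_zero_of_mod_eight_ne_one`): otherwise -1 is a square mod `p`, so `p ≡
5`, and the displayed equation with `p ∤ m` makes -2 a square, which is impossible. Units are norms
from the unramified extension `ℚ_p(√2)`.

The place 2: `4x²+1` is 1 mod 8 for even `x` and 5 mod 8 for odd `x`, so the invariant vanishes
exactly when `x` is even (`padicInv_two_eq_zero_iff`). If `ℓ ≡ 5 mod 8`, then `k ≡ 6 mod 8` and `x`,
`y` cannot both be even. If `ℓ ≡ 3 mod 8`, then `k ≡ 4 mod 8` and all coordinates are even; dividing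
by 4 leaves a sum of three squares mod 8, for which only the residue 7 is excluded. -/

noncomputable section

namespace MarkoffK3

/-! ### Splitting by a full idempotent of rank one -/

/-- If `e` is an idempotent of an algebra `A` over `S` such that `e A e = S e` and `A e A = A`, then
left multiplication identifies `A` with `End (A e)`. -/
theorem brauerTrivial_of_idempotent {S : Type} [CommRing S] {A : Type} [Ring A] [Algebra S A]
    [Module.Finite S A] [Module.Projective S A] [FaithfulSMul S A] {ι : Type} [Fintype ι] (e : A)
    (he : e * e = e) (lam : A → S) (hlam : ∀ x, e * x * e = lam x • e) (p q : ι → A)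
    (hpq : ∑ i, p i * e * q i = 1) : BrauerTrivial S A := by
  let P : Submodule A A := Submodule.span A {e}
  have heP : ∀ x : A, x * e ∈ P := fun x =>
    Submodule.mem_span_singleton.2 ⟨x, rfl⟩
  have hPe : ∀ x ∈ P, x * e = x := by
    intro x hx
    obtain ⟨y, rfl⟩ := Submodule.mem_span_singleton.1 hx
    simp [mul_assoc, he]
  let inc : P →ₗ[S] A := (P.subtype).restrictScalars S
  let pr : A →ₗ[S] P :=
    { toFun := fun x => ⟨x * e, heP x⟩
      map_add' := fun x y => Subtype.ext (add_mul x y e)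
      map_smul' := fun r x => Subtype.ext (smul_mul_assoc r x e) }
  have hpr : pr ∘ₗ inc = LinearMap.id := by
    ext x
    exact hPe x x.2
  refine ⟨P, inferInstance, inferInstance, ?_, Module.Projective.of_split inc pr hpr, ⟨?_⟩, ?_⟩
  · exact Module.Finite.of_surjective pr fun x => ⟨x, Subtype.ext (hPe x x.2)⟩
  · intro r r' h
    have h1 : r • e = r' • e := by
      have h2 := congrArg Subtype.val (h ⟨e, by simpa using heP 1⟩)
      exact h2
    have h3 : r • (1 : A) = r' • (1 : A) := by
      have key : ∀ r : S, r • (1 : A) = ∑ i, p i * (r • e) * q i := by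
        intro r
        rw [← hpq, Finset.smul_sum]
        refine Finset.sum_congr rfl fun i _ => ?_
        rw [mul_smul_comm, smul_mul_assoc]
      rw [key, key, h1]
    have := FaithfulSMul.algebraMap_injective S A
    apply this
    rw [Algebra.algebraMap_eq_smul_one, Algebra.algebraMap_eq_smul_one, h3]
  · refine ⟨AlgEquiv.ofBijective (Algebra.lsmul S S P) ⟨?_, ?_⟩⟩
    · rw [injective_iff_map_eq_zero]
      intro x hx
      have h1 : ∀ y : A, x * (y * e) = 0 := fun y =>
        congrArg Subtype.val (LinearMap.congr_fun hx ⟨y * e, heP y⟩)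
      calc x = ∑ i, x * (p i * e) * q i := by
            conv_lhs => rw [← mul_one x, ← hpq, Finset.mul_sum]
            simp only [mul_assoc]
        _ = 0 := by simp [h1]
    · intro f
      let f' : A → A := fun x => (f ⟨x * e, heP x⟩ : A)
      have hf' : ∀ (r : S) (x : A), f' (r • x) = r • f' x := by
        intro r x
        have h1 : (⟨r • x * e, heP _⟩ : P) = r • ⟨x * e, heP x⟩ :=
          Subtype.ext (smul_mul_assoc r x e)
        simp only [f', h1, map_smul]
        rfl
      have hfe : ∀ x, f' x * e = f' x := fun x => hPe _ (f _).2
      have hsum : ∀ g : ι → A, f' (∑ i, g i) = ∑ i, f' (g i) := by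
        intro g
        have h1 : (⟨(∑ i, g i) * e, heP _⟩ : P) = ∑ i, ⟨g i * e, heP _⟩ := by
          apply Subtype.ext
          simp [Finset.sum_mul]
        simp only [f', h1, map_sum]
        simp
      -- For `x = x e`, write `x = ∑ pᵢ e (qᵢ x) e`. Each `e (qᵢ x) e` is a scalar multiple of `e`,
      -- so `S`-linearity of `f` already determines `f x` from the values `f (pᵢ e)`.
      refine ⟨∑ i, f' (p i) * q i, ?_⟩
      ext ⟨x, hx⟩
      have hx' := hPe x hx
      have hxf : (f ⟨x, hx⟩ : A) = f' x := by
        simp only [f']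
        congr 2
        exact Subtype.ext hx'.symm
      change (∑ i, f' (p i) * q i) * x = (f ⟨x, hx⟩ : A)
      rw [hxf]
      calc (∑ i, f' (p i) * q i) * x = ∑ i, f' (p i * (e * (q i * x) * e)) := by
            rw [Finset.sum_mul]
            refine Finset.sum_congr rfl fun i _ => ?_
            rw [hlam, mul_smul_comm, hf']
            have h2 : f' (p i * e) = f' (p i) := by
              simp only [f', mul_assoc, he]
            rw [h2]
            calc f' (p i) * q i * x = f' (p i) * (e * (q i * x) * e) := by
                  conv_lhs => rw [← hx', ← hfe]
                  simp only [mul_assoc]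
              _ = _ := by rw [hlam, mul_smul_comm, hfe]
        _ = f' (∑ i, p i * e * q i * x) := by
            rw [hsum]
            refine Finset.sum_congr rfl fun i _ => ?_
            simp only [f', mul_assoc, he]
        _ = f' x := by rw [← Finset.sum_mul, hpq, one_mul]

/-! ### Clifford algebras of binary quadratic forms -/

/-- The Clifford algebra of the binary quadratic form `a X² + s X Y + b Y²` over `R`: the free module
on `1, u, v, u v`, where `u² = a`, `v² = b` and `u v + v u = s`. -/
@[ext]
structure BinaryClifford (R : Type) (a s b : R) where
  re : R
  cu : R
  cv : R
  cw : R

namespace BinaryClifford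

variable {R : Type} {a s b : R}

instance {S : Type} [SMul S R] : SMul S (BinaryClifford R a s b) :=
  ⟨fun r x => ⟨r • x.re, r • x.cu, r • x.cv, r • x.cw⟩⟩

section smul

variable {S : Type} [SMul S R] (r : S) (x : BinaryClifford R a s b)

@[simp] theorem re_smul : (r • x).re = r • x.re := rfl
@[simp] theorem cu_smul : (r • x).cu = r • x.cu := rfl
@[simp] theorem cv_smul : (r • x).cv = r • x.cv := rfl
@[simp] theorem cw_smul : (r • x).cw = r • x.cw := rfl

end smul

variable [CommRing R]

instance : Zero (BinaryClifford R a s b) := ⟨⟨0, 0, 0, 0⟩⟩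
instance : One (BinaryClifford R a s b) := ⟨⟨1, 0, 0, 0⟩⟩
instance : Add (BinaryClifford R a s b) :=
  ⟨fun x y => ⟨x.re + y.re, x.cu + y.cu, x.cv + y.cv, x.cw + y.cw⟩⟩
instance : Neg (BinaryClifford R a s b) := ⟨fun x => ⟨-x.re, -x.cu, -x.cv, -x.cw⟩⟩
instance : Sub (BinaryClifford R a s b) :=
  ⟨fun x y => ⟨x.re - y.re, x.cu - y.cu, x.cv - y.cv, x.cw - y.cw⟩⟩
-- The coefficients are forced by `v u = s - u v`.
instance : Mul (BinaryClifford R a s b) :=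
  ⟨fun x y =>
    ⟨x.re * y.re + a * x.cu * y.cu + b * x.cv * y.cv + s * x.cv * y.cu - a * b * x.cw * y.cw,
      x.re * y.cu + x.cu * y.re - b * x.cv * y.cw + s * x.cw * y.cu + b * x.cw * y.cv,
      x.re * y.cv + x.cv * y.re + a * x.cu * y.cw + s * x.cv * y.cw - a * x.cw * y.cu,
      x.re * y.cw + x.cw * y.re + x.cu * y.cv - x.cv * y.cu + s * x.cw * y.cw⟩⟩

section projections

variable (x y : BinaryClifford R a s b)

@[simp] theorem re_zero : (0 : BinaryClifford R a s b).re = 0 := rfl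
@[simp] theorem cu_zero : (0 : BinaryClifford R a s b).cu = 0 := rfl
@[simp] theorem cv_zero : (0 : BinaryClifford R a s b).cv = 0 := rfl
@[simp] theorem cw_zero : (0 : BinaryClifford R a s b).cw = 0 := rfl
@[simp] theorem re_one : (1 : BinaryClifford R a s b).re = 1 := rfl
@[simp] theorem cu_one : (1 : BinaryClifford R a s b).cu = 0 := rfl
@[simp] theorem cv_one : (1 : BinaryClifford R a s b).cv = 0 := rfl
@[simp] theorem cw_one : (1 : BinaryClifford R a s b).cw = 0 := rfl
@[simp] theorem re_add : (x + y).re = x.re + y.re := rfl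
@[simp] theorem cu_add : (x + y).cu = x.cu + y.cu := rfl
@[simp] theorem cv_add : (x + y).cv = x.cv + y.cv := rfl
@[simp] theorem cw_add : (x + y).cw = x.cw + y.cw := rfl
@[simp] theorem re_neg : (-x).re = -x.re := rfl
@[simp] theorem cu_neg : (-x).cu = -x.cu := rfl
@[simp] theorem cv_neg : (-x).cv = -x.cv := rfl
@[simp] theorem cw_neg : (-x).cw = -x.cw := rfl
@[simp] theorem re_sub : (x - y).re = x.re - y.re := rfl
@[simp] theorem cu_sub : (x - y).cu = x.cu - y.cu := rfl
@[simp] theorem cv_sub : (x - y).cv = x.cv - y.cv := rfl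
@[simp] theorem cw_sub : (x - y).cw = x.cw - y.cw := rfl
@[simp] theorem re_mul : (x * y).re = x.re * y.re + a * x.cu * y.cu + b * x.cv * y.cv
    + s * x.cv * y.cu - a * b * x.cw * y.cw := rfl
@[simp] theorem cu_mul : (x * y).cu = x.re * y.cu + x.cu * y.re - b * x.cv * y.cw
    + s * x.cw * y.cu + b * x.cw * y.cv := rfl
@[simp] theorem cv_mul : (x * y).cv = x.re * y.cv + x.cv * y.re + a * x.cu * y.cw
    + s * x.cv * y.cw - a * x.cw * y.cu := rfl
@[simp] theorem cw_mul : (x * y).cw = x.re * y.cw + x.cw * y.re + x.cu * y.cv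
    - x.cv * y.cu + s * x.cw * y.cw := rfl

end projections

instance : AddCommGroup (BinaryClifford R a s b) where
  add_assoc x y z := by ext <;> simp [add_assoc]
  zero_add x := by ext <;> simp
  add_zero x := by ext <;> simp
  add_comm x y := by ext <;> simp [add_comm]
  neg_add_cancel x := by ext <;> simp
  sub_eq_add_neg x y := by ext <;> simp [sub_eq_add_neg]
  nsmul := nsmulRec
  zsmul := zsmulRec

instance : Ring (BinaryClifford R a s b) where
  __ := (inferInstance : AddCommGroup (BinaryClifford R a s b))
  left_distrib x y z := by ext <;> simp <;> ring
  right_distrib x y z := by ext <;> simp <;> ring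
  zero_mul x := by ext <;> simp
  mul_zero x := by ext <;> simp
  mul_assoc x y z := by ext <;> simp <;> ring
  one_mul x := by ext <;> simp
  mul_one x := by ext <;> simp

instance {S : Type} [CommRing S] [Algebra S R] : Module S (BinaryClifford R a s b) where
  one_smul x := by ext <;> simp
  mul_smul r t x := by ext <;> simp [mul_smul]
  smul_zero r := by ext <;> simp
  smul_add r x y := by ext <;> simp
  add_smul r t x := by ext <;> simp [add_smul]
  zero_smul x := by ext <;> simp

instance {S : Type} [CommRing S] [Algebra S R] : Algebra S (BinaryClifford R a s b) :=
  Algebra.ofModule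
    (fun r x y => by ext <;> simp [Algebra.smul_def] <;> ring)
    (fun r x y => by ext <;> simp [Algebra.smul_def] <;> ring)

/-- The coordinates with respect to the basis `1, u, v, u v`. -/
def equivTuple (R : Type) [CommRing R] (a s b : R) : BinaryClifford R a s b ≃ₗ[R] (Fin 4 → R) where
  toFun x := ![x.re, x.cu, x.cv, x.cw]
  invFun f := ⟨f 0, f 1, f 2, f 3⟩
  map_add' x y := by ext i; fin_cases i <;> rfl
  map_smul' r x := by ext i; fin_cases i <;> rfl
  left_inv _ := rfl
  right_inv f := by ext i; fin_cases i <;> rfl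

/-- The basis `1, u, v, u v`. -/
def basis (R : Type) [CommRing R] (a s b : R) : Module.Basis (Fin 4) R (BinaryClifford R a s b) :=
  .ofEquivFun (equivTuple R a s b)

theorem basis_eq (i : Fin 4) : basis R a s b i =
    ⟨(Pi.single i 1 : Fin 4 → R) 0, (Pi.single i 1 : Fin 4 → R) 1, (Pi.single i 1 : Fin 4 → R) 2,
      (Pi.single i 1 : Fin 4 → R) 3⟩ := by
  rw [basis, Module.Basis.coe_ofEquivFun]
  rfl

instance : Module.Free R (BinaryClifford R a s b) := .of_basis (basis R a s b)
instance : Module.Finite R (BinaryClifford R a s b) := .of_basis (basis R a s b)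

instance : FaithfulSMul R (BinaryClifford R a s b) where
  eq_of_smul_eq_smul {r r'} h := by simpa using congrArg re (h 1)

/-- The reduced trace. -/
def trd (x : BinaryClifford R a s b) : R := 2 * x.re + s * x.cw

/-- The reduced norm. -/
def nrd (x : BinaryClifford R a s b) : R :=
  x.re ^ 2 + s * x.re * x.cw - a * x.cu ^ 2 - s * x.cu * x.cv - b * x.cv ^ 2 + a * b * x.cw ^ 2

/-- The canonical involution. -/
def conj (x : BinaryClifford R a s b) : BinaryClifford R a s b :=
  ⟨x.re + s * x.cw, -x.cu, -x.cv, -x.cw⟩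

theorem mul_self_eq (x : BinaryClifford R a s b) : x * x = trd x • x - nrd x • 1 := by
  ext <;> simp [trd, nrd] <;> ring

theorem conj_mul (x : BinaryClifford R a s b) : conj x * x = nrd x • 1 := by
  ext <;> simp [conj, nrd] <;> ring

theorem conj_mul_rev (x y : BinaryClifford R a s b) : conj (x * y) = conj y * conj x := by
  ext <;> simp [conj] <;> ring

/-- Put `y = x e`. Then `y = trd y - conj y` and `conj y = conj e * conj x`, while `e * conj e = nrd
e`. For `trd e = 1`, `nrd e = 0` this gives `e A e ⊆ R e`, as the splitting criterion requires. -/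
theorem mul_mul_self (e x : BinaryClifford R a s b) :
    e * x * e = trd (x * e) • e - nrd e • conj x := by
  ext <;> simp [trd, nrd, conj] <;> ring

/-- The basis dual to `1, u, v, u v` with respect to the trace form, scaled by the discriminant
`s² - 4 a b`. -/
def dualBasis (R : Type) [CommRing R] (a s b : R) : Fin 4 → BinaryClifford R a s b :=
  ![⟨s ^ 2 - 2 * a * b, 0, 0, -s⟩, ⟨0, -2 * b, s, 0⟩, ⟨0, s, -2 * a, 0⟩, ⟨-s, 0, 0, 2⟩]

/-- The Casimir element of the trace form turns any `x` into a scalar. It serves twice: to write 1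
as `∑ pᵢ e qᵢ` when `trd e = 1`, and to produce every endomorphism from left and right
multiplications. -/
theorem sum_basis_mul_dualBasis (x : BinaryClifford R a s b) :
    ∑ i, basis R a s b i * x * dualBasis R a s b i = ((s ^ 2 - 4 * a * b) * trd x) • 1 := by
  ext <;> simp [Fin.sum_univ_four, basis_eq, dualBasis, trd] <;> ring

theorem sum_trd_smul_basis (x : BinaryClifford R a s b) :
    ∑ i, trd (x * dualBasis R a s b i) • basis R a s b i = (s ^ 2 - 4 * a * b) • x := by
  ext <;> simp [Fin.sum_univ_four, basis_eq, dualBasis, trd] <;> ring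

/-- The Clifford algebra of a nondegenerate binary quadratic form is an Azumaya algebra. -/
theorem isAzumaya (hD : IsUnit (s ^ 2 - 4 * a * b)) : IsAzumaya R (BinaryClifford R a s b) where
  bij := by
    have hsurj : Function.Surjective (AlgHom.mulLeftRight R (BinaryClifford R a s b)) := by
      intro f
      obtain ⟨δ, hδ⟩ := hD.exists_right_inv
      -- Summing over `j` gives the discriminant `D` times `trd (x bᵢ*)`. Summing over `i` then
      -- expands `x` in the basis at the cost of a second `D`, and `δ = D⁻¹` cancels both.
      refine ⟨∑ i, ∑ j, (δ ^ 2 • (f (basis R a s b i) * basis R a s b j)) ⊗ₜ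
        MulOpposite.op (dualBasis R a s b i * dualBasis R a s b j), ?_⟩
      ext1 x
      simp only [map_sum, LinearMap.sum_apply, AlgHom.mulLeftRight_apply, MulOpposite.unop_op]
      calc _ = ∑ i, (δ ^ 2 • f (basis R a s b i)) *
              ∑ j, basis R a s b j * (x * dualBasis R a s b i) * dualBasis R a s b j := by
            refine Finset.sum_congr rfl fun i _ => ?_
            rw [Finset.mul_sum]
            refine Finset.sum_congr rfl fun j _ => ?_
            simp only [mul_assoc, smul_mul_assoc]
        _ = δ • f (δ • ∑ i, (s ^ 2 - 4 * a * b) •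
              trd (x * dualBasis R a s b i) • basis R a s b i) := by
            rw [map_smul, map_sum, Finset.smul_sum, Finset.smul_sum]
            refine Finset.sum_congr rfl fun i _ => ?_
            rw [sum_basis_mul_dualBasis, mul_smul_comm, mul_one, map_smul, map_smul]
            simp only [smul_smul]
            congr 1
            ring
        _ = f x := by
            rw [← Finset.smul_sum, sum_trd_smul_basis]
            simp only [← map_smul, smul_smul]
            congr 1
            rw [show δ * (δ * ((s ^ 2 - 4 * a * b) * (s ^ 2 - 4 * a * b))) =
              ((s ^ 2 - 4 * a * b) * δ) ^ 2 by ring, hδ, one_pow, one_smul]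
    -- Source and target are isomorphic finite modules, so surjectivity suffices.
    refine OrzechProperty.bijective_of_surjective_of_injective
      ?_ (AlgHom.mulLeftRight R (BinaryClifford R a s b)).toLinearMap ?_ hsurj
    · exact ((TensorProduct.congr (LinearEquiv.refl R _)
        (MulOpposite.opLinearEquiv R).symm).trans
        ((TensorProduct.congr ((basis R a s b).toDualEquiv)
          (LinearEquiv.refl R _)).trans (dualTensorHomEquiv R _ _))).toLinearMap
    · exact LinearEquiv.injective _

/-- Over a ring in which the discriminant is invertible, the Clifford algebra is split by an element
of trace `1` and norm `0`. -/
theorem brauerTrivial_of_trd_eq_one (hD : IsUnit (s ^ 2 - 4 * a * b)) (e : BinaryClifford R a s b)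
    (ht : trd e = 1) (hn : nrd e = 0) : BrauerTrivial R (BinaryClifford R a s b) := by
  obtain ⟨δ, hδ⟩ := hD.exists_right_inv
  refine brauerTrivial_of_idempotent e ?_ (fun x => trd (x * e)) (fun x => ?_)
    (fun i => δ • basis R a s b i) (dualBasis R a s b) ?_
  · rw [mul_self_eq, ht, hn, one_smul, zero_smul, sub_zero]
  · rw [mul_mul_self, hn, zero_smul, sub_zero]
  · simp only [smul_mul_assoc]
    rw [← Finset.smul_sum, sum_basis_mul_dualBasis, ht, mul_one, smul_smul, mul_comm, hδ, one_smul]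

/-- The Clifford algebra is isomorphic to its opposite. -/
def conjEquiv : BinaryClifford R a s b ≃ₐ[R] (BinaryClifford R a s b)ᵐᵒᵖ where
  toFun x := MulOpposite.op (conj x)
  invFun x := conj x.unop
  left_inv x := by ext <;> simp [conj]
  right_inv x := by
    apply MulOpposite.unop_injective
    ext <;> simp [conj]
  map_mul' x y := by rw [conj_mul_rev, MulOpposite.op_mul]
  map_add' x y := by
    apply MulOpposite.unop_injective
    ext <;> simp [conj] <;> ring
  commutes' r := by
    apply MulOpposite.unop_injective
    rw [Algebra.algebraMap_eq_smul_one, Algebra.algebraMap_eq_smul_one]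
    ext <;> simp [conj]

/-- The canonical involution gives `A ⊗ A ≅ A ⊗ Aᵒᵖ`, which is `End A` by the Azumaya property. -/
theorem brauerTrivial_tensor_self (hD : IsUnit (s ^ 2 - 4 * a * b)) :
    BrauerTrivial R (BinaryClifford R a s b ⊗[R] BinaryClifford R a s b) := by
  have := isAzumaya hD
  exact ⟨BinaryClifford R a s b, inferInstance, inferInstance, inferInstance, inferInstance,
    inferInstance, ⟨(Algebra.TensorProduct.congr AlgEquiv.refl conjEquiv).trans
      (AlgEquiv.ofBijective _ this.bij)⟩⟩

end BinaryClifford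

/-! ### Base change and splitting criteria -/

theorem BrauerTrivial.of_algEquiv {R : Type} [CommRing R] {A B : Type} [Ring A] [Algebra R A]
    [Ring B] [Algebra R B] (e : A ≃ₐ[R] B) (h : BrauerTrivial R A) : BrauerTrivial R B := by
  obtain ⟨P, i₁, i₂, h₁, h₂, h₃, ⟨f⟩⟩ := h
  exact ⟨P, i₁, i₂, h₁, h₂, h₃, ⟨e.symm.trans f⟩⟩

theorem BrauerEquivalent.of_algEquiv {R : Type} [CommRing R] {A B : Type} [Ring A] [Algebra R A]
    [Ring B] [Algebra R B] (e : A ≃ₐ[R] B) : BrauerEquivalent R A B :=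
  ⟨R, R, inferInstance, inferInstance, inferInstance, inferInstance, inferInstance, inferInstance,
    inferInstance, inferInstance, inferInstance, inferInstance,
    ⟨Algebra.TensorProduct.congr e AlgEquiv.refl⟩⟩

namespace BinaryClifford

theorem algebraMap_eq {S R : Type} [CommRing S] [CommRing R] [Algebra S R] {a s b : R} (r : S) :
    algebraMap S (BinaryClifford R a s b) r = ⟨algebraMap S R r, 0, 0, 0⟩ := by
  rw [Algebra.algebraMap_eq_smul_one]
  ext
  · rw [re_smul, re_one, Algebra.algebraMap_eq_smul_one]
  · rw [cu_smul, cu_one, smul_zero]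
  · rw [cv_smul, cv_one, smul_zero]
  · rw [cw_smul, cw_one, smul_zero]

section baseChange

variable {R S : Type} [CommRing R] [CommRing S] [Algebra R S] {a s b : R} {a' s' b' : S}

instance : IsScalarTower R S (BinaryClifford S a' s' b') where
  smul_assoc r t x := by ext <;> simp

/-- The map of Clifford algebras induced by a homomorphism of the base rings. -/
def mapAlgHom (ha : algebraMap R S a = a') (hs : algebraMap R S s = s')
    (hb : algebraMap R S b = b') : BinaryClifford R a s b →ₐ[R] BinaryClifford S a' s' b' where
  toFun x := ⟨algebraMap R S x.re, algebraMap R S x.cu, algebraMap R S x.cv, algebraMap R S x.cw⟩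
  map_one' := by ext <;> simp
  map_mul' x y := by ext <;> simp [← ha, ← hs, ← hb]
  map_zero' := by ext <;> simp
  map_add' x y := by ext <;> simp
  commutes' r := by
    rw [algebraMap_eq, algebraMap_eq]
    ext <;> simp

/-- The formation of the Clifford algebra commutes with base change. -/
def baseChangeHom (ha : algebraMap R S a = a') (hs : algebraMap R S s = s')
    (hb : algebraMap R S b = b') :
    S ⊗[R] BinaryClifford R a s b →ₐ[S] BinaryClifford S a' s' b' :=
  Algebra.TensorProduct.lift (Algebra.ofId S _) (mapAlgHom ha hs hb)
    fun r _ => show Commute _ _ from Algebra.commutes r _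

theorem baseChangeHom_bijective (ha : algebraMap R S a = a') (hs : algebraMap R S s = s')
    (hb : algebraMap R S b = b') : Function.Bijective (baseChangeHom ha hs hb) := by
  have h : (baseChangeHom ha hs hb).toLinearMap =
      (((basis R a s b).baseChange S).equiv (basis S a' s' b') (Equiv.refl _)).toLinearMap := by
    refine ((basis R a s b).baseChange S).ext fun i => ?_
    rw [LinearEquiv.coe_coe, Module.Basis.equiv_apply, Module.Basis.baseChange_apply,
      AlgHom.toLinearMap_apply, baseChangeHom, Algebra.TensorProduct.lift_tmul, map_one, one_mul,
      Equiv.refl_apply, basis_eq, basis_eq]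
    fin_cases i <;> ext <;> simp [mapAlgHom]
  have h' : ⇑(baseChangeHom ha hs hb) =
      ⇑(((basis R a s b).baseChange S).equiv (basis S a' s' b') (Equiv.refl _)) :=
    funext fun x => LinearMap.congr_fun h x
  rw [h']
  exact LinearEquiv.bijective _

/-- The formation of the Clifford algebra commutes with base change. -/
def baseChangeEquiv (ha : algebraMap R S a = a') (hs : algebraMap R S s = s')
    (hb : algebraMap R S b = b') :
    S ⊗[R] BinaryClifford R a s b ≃ₐ[S] BinaryClifford S a' s' b' :=
  AlgEquiv.ofBijective _ (baseChangeHom_bijective ha hs hb)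

end baseChange

theorem splitBy_iff {R S : Type} [CommRing R] [CommRing S] (φ : R →+* S) {a s b : R} :
    SplitBy φ (BinaryClifford R a s b) ↔ BrauerTrivial S (BinaryClifford S (φ a) (φ s) (φ b)) := by
  let _ : Algebra R S := φ.toAlgebra
  let e : S ⊗[R] BinaryClifford R a s b ≃ₐ[S] BinaryClifford S (φ a) (φ s) (φ b) :=
    baseChangeEquiv rfl rfl rfl
  exact ⟨fun h => BrauerTrivial.of_algEquiv e h, fun h => BrauerTrivial.of_algEquiv e.symm h⟩

/-- If `a` is invertible, then the Clifford algebra of `a X² + 2 t X Y + b Y²` is the quaternion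
algebra `(a, t² - a b)`. -/
def quaternionEquiv {S : Type} [CommRing S] {a s b t d a' : S} (ha : a * a' = 1) (hs : s = 2 * t)
    (hd : d = t ^ 2 - a * b) : ℍ[S, a, d] ≃ₐ[S] BinaryClifford S a s b where
  -- `i ↦ u` and `j ↦ u v - t`, which anticommutes with `u` and has square `t² - a b`; hence `ij ↦ a
  -- v - t u`.
  toFun q := ⟨q.re - t * q.imJ, q.imI - t * q.imK, a * q.imK, q.imJ⟩
  invFun x := ⟨x.re + t * x.cw, x.cu + t * a' * x.cv, x.cw, a' * x.cv⟩
  left_inv q := by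
    ext
    · simp
    · simp only; linear_combination t * q.imK * ha
    · simp
    · simp only; linear_combination q.imK * ha
  right_inv x := by
    ext
    · simp
    · simp only; ring
    · simp only; linear_combination x.cv * ha
    · simp
  map_mul' x y := by
    subst hs hd
    ext <;> simp <;> ring
  map_add' x y := by ext <;> simp <;> ring
  commutes' r := by
    rw [algebraMap_eq]
    ext <;> simp

theorem brauerTrivial_of_disc_eq_sq {S : Type} [CommRing S] {a s b : S} (h2 : IsUnit (2 : S))
    (hD : IsUnit (s ^ 2 - 4 * a * b)) (σ : S) (hσ : σ ^ 2 = s ^ 2 - 4 * a * b) :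
    BrauerTrivial S (BinaryClifford S a s b) := by
  obtain ⟨η, hη⟩ := h2.exists_right_inv
  have hσ' : IsUnit σ := by
    rw [← hσ] at hD
    exact (isUnit_pow_iff two_ne_zero).1 hD
  obtain ⟨τ, hτ⟩ := hσ'.exists_right_inv
  -- With `J = 2 u v - s`, `J² = σ²`, this is the idempotent `(1 + J/σ)/2`.
  refine brauerTrivial_of_trd_eq_one hD ⟨η * (1 - s * τ), 0, 0, τ⟩ ?_ ?_
  · simp only [trd]
    linear_combination (1 - s * τ) * hη
  · have h1 : 2 * (η * (1 - s * τ)) = 1 - s * τ := by linear_combination (1 - s * τ) * hη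
    have h4 : 4 * nrd (⟨η * (1 - s * τ), 0, 0, τ⟩ : BinaryClifford S a s b) = 0 := by
      simp only [nrd]
      linear_combination (2 * (η * (1 - s * τ)) + 1 + s * τ) * h1 + τ ^ 2 * hσ - (σ * τ + 1) * hτ
    linear_combination η ^ 2 * h4 - (2 * η + 1) *
      nrd (⟨η * (1 - s * τ), 0, 0, τ⟩ : BinaryClifford S a s b) * hη

theorem brauerTrivial_of_norm {K : Type} [Field K] {a s b : K} (h2 : (2 : K) ≠ 0)
    (hD : s ^ 2 - 4 * a * b ≠ 0) (p q : K) (ha : a ≠ 0)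
    (h : a = p ^ 2 - (s ^ 2 - 4 * a * b) * q ^ 2) :
    BrauerTrivial K (BinaryClifford K a s b) := by
  have h4 : (4 : K) ≠ 0 := by
    rw [show (4 : K) = 2 * 2 by norm_num]
    exact mul_ne_zero h2 h2
  by_cases hp : p = 0
  · have hq : q ≠ 0 := by
      rintro rfl
      apply ha
      rw [h, hp]
      ring
    -- Put `J = 2 u v - s` and `D = J²`. Here `a = -D q²`, so `(u J)² = -a D = (D q)²` and `(1 + u
    -- J/(D q))/2` is an idempotent.
    refine brauerTrivial_of_trd_eq_one (isUnit_iff_ne_zero.2 hD)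
      ⟨1 / 2, -s / (2 * (s ^ 2 - 4 * a * b) * q), a / ((s ^ 2 - 4 * a * b) * q), 0⟩ ?_ ?_
    · simp only [trd]
      field_simp
      ring
    · have h1 : ∀ E : K, E ≠ 0 → nrd (⟨1 / 2, -s / (2 * E * q), a / (E * q), 0⟩ :
          BinaryClifford K a s b) = 1 / 4 + a * (s ^ 2 - 4 * a * b) / (4 * E ^ 2 * q ^ 2) := by
        intro E hE
        simp only [nrd]
        field_simp
        ring
      have h2' : a + (s ^ 2 - 4 * a * b) * q ^ 2 = 0 := by rw [hp] at h; linear_combination h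
      rw [h1 _ hD]
      generalize s ^ 2 - 4 * a * b = D at hD h2'
      field_simp
      linear_combination h2'
  -- As `u` and `J = 2 u v - s` anticommute, `(u + q J)² = a + D q² = p²`; the idempotent is `(1 +
  -- (u + q J)/p)/2`.
  · refine brauerTrivial_of_trd_eq_one (isUnit_iff_ne_zero.2 hD)
      ⟨1 / 2 - s * q / (2 * p), 1 / (2 * p), 0, q / p⟩ ?_ ?_
    · simp only [trd]
      field_simp
      ring
    · have h1 : nrd (⟨1 / 2 - s * q / (2 * p), 1 / (2 * p), 0, q / p⟩ : BinaryClifford K a s b) =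
          (p ^ 2 - (s ^ 2 - 4 * a * b) * q ^ 2 - a) / (4 * p ^ 2) := by
        simp only [nrd]
        field_simp
        ring
      rw [h1, ← h, sub_self, zero_div]

/-- A Clifford algebra with anisotropic norm form is not split. -/
theorem not_brauerTrivial_of_anisotropic {K : Type} [Field K] {a s b : K}
    (h : ∀ x : BinaryClifford K a s b, nrd x = 0 → x = 0) :
    ¬ BrauerTrivial K (BinaryClifford K a s b) := by
  rintro ⟨P, _, _, _, _, _, ⟨f⟩⟩
  have hdom : ∀ x y : BinaryClifford K a s b, x * y = 0 → x = 0 ∨ y = 0 := by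
    intro x y hxy
    by_cases hx : nrd x = 0
    · exact .inl (h x hx)
    · right
      have h1 : nrd x • y = 0 := by
        calc nrd x • y = conj x * x * y := by rw [conj_mul, smul_mul_assoc, one_mul]
          _ = 0 := by rw [mul_assoc, hxy, mul_zero]
      exact (smul_eq_zero.1 h1).resolve_left hx
  have hdim : Module.finrank K P * Module.finrank K P = 4 := by
    rw [← Module.finrank_linearMap K K P P, ← f.toLinearEquiv.finrank_eq,
      Module.finrank_eq_card_basis (basis K a s b), Fintype.card_fin]
  have hnt : Nontrivial P := by
    by_contra hnt
    rw [not_nontrivial_iff_subsingleton] at hnt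
    rw [Module.finrank_zero_of_subsingleton] at hdim
    omega
  obtain ⟨v, hv⟩ := exists_ne (0 : P)
  obtain ⟨g, hg⟩ := Module.Projective.exists_dual_ne_zero K hv
  -- A projection onto the line of `v`. In a domain `e (1 - e) = 0` forces `e = 1`, so `P` would be
  -- a line, whereas `dim P = 2`.
  let e : Module.End K P := (g v)⁻¹ • g.smulRight v
  have hex : ∀ x, e x = ((g v)⁻¹ * g x) • v := fun x => by simp [e, smul_smul]
  have hev : e v = v := by rw [hex, inv_mul_cancel₀ hg, one_smul]
  have he : e * e = e := by
    ext x
    rw [Module.End.mul_apply, hex x, map_smul, hev]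
  have h0 : f.symm e * f.symm (1 - e) = 0 := by
    rw [← map_mul, mul_sub, mul_one, he, sub_self, map_zero]
  rcases hdom _ _ h0 with h1 | h1
  · have : e = 0 := by simpa using h1
    rw [this] at hev
    exact hv hev.symm
  · have h2 : 1 - e = 0 := (map_eq_zero_iff f.symm f.symm.injective).1 h1
    have h3 : Module.finrank K P ≤ 1 := by
      refine finrank_le_one v fun x => ⟨(g v)⁻¹ * g x, ?_⟩
      have := LinearMap.congr_fun h2 x
      simp only [LinearMap.sub_apply, Module.End.one_apply, LinearMap.zero_apply, sub_eq_zero] at this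
      rw [← hex, ← this]
    interval_cases Module.finrank K P <;> omega

end BinaryClifford

open BinaryClifford

/-! ### The two classes on the surface -/

theorem F₃_coord (k : ℤ) : F₃ (coord k 0) (coord k 1) (coord k 2) = (k : CoordRing k) := by
  have h : Ideal.Quotient.mk (Ideal.span {poly k}) (poly k) = 0 :=
    Ideal.Quotient.eq_zero_iff_mem.2 (Ideal.mem_span_singleton_self _)
  rw [← sub_eq_zero, ← h]
  rfl

/-- Twice the polar form coefficient `8 y z`. -/
def polarFun (k : ℤ) (i : Fin 3) : CoordRing k := 2 * (8 * coord k (i + 1) * coord k (i + 2))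

/-- The second diagonal coefficient of the binary form whose Clifford algebra extends the quaternion
algebra `(4 x² + 1, 2 (4 k + 1))`. -/
def coquadFun (k : ℤ) (i : Fin 3) : CoordRing k :=
  -2 * ((4 * coord k (i + 1) ^ 2 + 1) * (4 * coord k (i + 2) ^ 2 + 1)
    - 32 * coord k (i + 1) ^ 2 * coord k (i + 2) ^ 2)

/-- The choice of `coquadFun` makes the discriminant constant modulo the equation of the surface, so
the algebra stays Azumaya along `4 xᵢ² + 1 = 0`. -/
theorem disc_eq (k : ℤ) (i : Fin 3) :
    polarFun k i ^ 2 - 4 * quadFun k i * coquadFun k i = 8 * (4 * (k : CoordRing k) + 1) := by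
  have h := F₃_coord k
  simp only [F₃] at h
  have h1 : (1 : Fin 3) + 2 = 0 := rfl
  have h2 : (2 : Fin 3) + 1 = 0 := rfl
  have h3 : (2 : Fin 3) + 2 = 1 := rfl
  have h4 : (1 : Fin 3) + 1 = 2 := rfl
  simp only [polarFun, quadFun, coquadFun]
  fin_cases i
  · simp only [Fin.zero_eta, zero_add]
    linear_combination 32 * h
  · simp only [Fin.mk_one, h1, h4]
    linear_combination 32 * h
  · simp only [Fin.reduceFinMk, h2, h3]
    linear_combination 32 * h

theorem isUnit_intCast {R : Type} [CommRing R] [Algebra ℚ R] {n : ℤ} (hn : n ≠ 0) :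
    IsUnit (n : R) := by
  rw [← map_intCast (algebraMap ℚ R)]
  exact (isUnit_iff_ne_zero.2 (Int.cast_ne_zero.2 hn)).map _

theorem isUnit_disc (k : ℤ) (i : Fin 3) :
    IsUnit (polarFun k i ^ 2 - 4 * quadFun k i * coquadFun k i) := by
  have h := isUnit_intCast (R := CoordRing k) (show 8 * (4 * k + 1) ≠ 0 by omega)
  rw [disc_eq]
  exact_mod_cast h

/-- An Azumaya algebra on `U_k` representing the class `(4 xᵢ² + 1, 2 (4 k + 1))`. -/
def quatClass (k : ℤ) (i : Fin 3) : AzumayaAlgebra (CoordRing k) where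
  carrier := BinaryClifford (CoordRing k) (quadFun k i) (polarFun k i) (coquadFun k i)
  isAzumaya := isAzumaya (isUnit_disc k i)

theorem representsQuaternionClass_quatClass (k : ℤ) (i : Fin 3) :
    RepresentsQuaternionClass k i (quatClass k i) := by
  let L := Localization.Away (quadFun k i)
  let ψ := algebraMap (CoordRing k) L
  obtain ⟨a', ha'⟩ := (IsLocalization.Away.algebraMap_isUnit (S := L) (quadFun k i)).exists_right_inv
  refine BrauerEquivalent.of_algEquiv
    ((baseChangeEquiv (a' := ψ (quadFun k i)) (s' := ψ (polarFun k i)) (b' := ψ (coquadFun k i))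
      rfl rfl rfl).trans (quaternionEquiv (t := ψ (8 * coord k (i + 1) * coord k (i + 2))) ha' ?_
        ?_).symm)
  · rw [polarFun, map_mul, map_ofNat]
  · have h : 2 * (4 * (k : CoordRing k) + 1) =
        (8 * coord k (i + 1) * coord k (i + 2)) ^ 2 - quadFun k i * coquadFun k i := by
      have h1 := disc_eq k i
      have h4 := isUnit_intCast (R := CoordRing k) (show (4 : ℤ) ≠ 0 by decide)
      rw [polarFun] at h1
      refine h4.mul_left_cancel ?_
      push_cast
      linear_combination -h1
    rw [← map_pow, ← map_mul, ← map_sub, ← h]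
    simp only [map_mul, map_add, map_one, map_intCast, map_ofNat ψ 2, map_ofNat ψ 4, eq_intCast]
    push_cast
    rfl

theorem isTwoTorsion_quatClass (k : ℤ) (i : Fin 3) : IsTwoTorsion (quatClass k i) :=
  brauerTrivial_tensor_self (isUnit_disc k i)

/-- The discriminant `8 m²` is the square of `2 m √2`. This covers `ℚ̄`, `ℝ` and `ℚ_p` for `p ≡ ±1
mod 8`. -/
theorem splitBy_of_two_eq_sq {k m : ℤ} (hm : 4 * k + 1 = m ^ 2) (i : Fin 3) {S : Type} [CommRing S]
    [Algebra ℚ S] (φ : CoordRing k →+* S) (σ : S) (hσ : σ ^ 2 = 2) :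
    SplitBy φ (quatClass k i).carrier := by
  refine (splitBy_iff φ).2 ?_
  have hmS : 4 * (k : S) + 1 = (m : S) ^ 2 := by exact_mod_cast congrArg (Int.cast : ℤ → S) hm
  have hd : φ (polarFun k i) ^ 2 - 4 * φ (quadFun k i) * φ (coquadFun k i) =
      φ (polarFun k i ^ 2 - 4 * quadFun k i * coquadFun k i) := by
    rw [map_sub, map_pow, map_mul, map_mul, map_ofNat φ 4]
  refine brauerTrivial_of_disc_eq_sq ?_ ?_ (2 * m * σ) ?_
  · exact_mod_cast isUnit_intCast (R := S) (show (2 : ℤ) ≠ 0 by decide)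
  · rw [hd]
    exact (isUnit_disc k i).map φ
  · rw [hd, disc_eq]
    simp only [map_mul, map_add, map_one, map_intCast, map_ofNat φ 4, map_ofNat φ 8]
    rw [hmS]
    linear_combination 4 * (m : S) ^ 2 * hσ

theorem isAlgebraic_quatClass {k m : ℤ} (hm : 4 * k + 1 = m ^ 2) (i : Fin 3) :
    IsAlgebraic k (quatClass k i) := by
  obtain ⟨σ, hσ⟩ := IsAlgClosed.exists_pow_nat_eq (2 : AlgebraicClosure ℚ) two_pos
  refine splitBy_of_two_eq_sq hm i _
    ((Algebra.TensorProduct.includeLeft :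
      AlgebraicClosure ℚ →ₐ[ℚ] AlgebraicClosure ℚ ⊗[ℚ] CoordRing k) σ) ?_
  rw [← map_pow, hσ, map_ofNat]

theorem disc_map_eq {k m : ℤ} (hm : 4 * k + 1 = m ^ 2) (i : Fin 3) {K : Type} [Field K]
    (φ : CoordRing k →+* K) : φ (polarFun k i) ^ 2 - 4 * φ (quadFun k i) * φ (coquadFun k i) =
    8 * (m : K) ^ 2 := by
  have hmK : 4 * (k : K) + 1 = (m : K) ^ 2 := by exact_mod_cast congrArg (Int.cast : ℤ → K) hm
  have hd : φ (polarFun k i) ^ 2 - 4 * φ (quadFun k i) * φ (coquadFun k i) =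
      φ (polarFun k i ^ 2 - 4 * quadFun k i * coquadFun k i) := by
    rw [map_sub, map_pow, map_mul, map_mul, map_ofNat φ 4]
  rw [hd, disc_eq, ← hmK]
  simp only [map_mul, map_add, map_one, map_intCast, map_ofNat φ 4, map_ofNat φ 8]

theorem splitBy_of_norm {k m : ℤ} (hm : 4 * k + 1 = m ^ 2) (i : Fin 3) {K : Type} [Field K]
    [Algebra ℚ K] (φ : CoordRing k →+* K) (p q : K) (ha : φ (quadFun k i) ≠ 0)
    (h : φ (quadFun k i) = p ^ 2 - 2 * q ^ 2) : SplitBy φ (quatClass k i).carrier := by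
  have : CharZero K := algebraRat.charZero K
  have hd := disc_map_eq hm i φ
  have hm0 : (m : K) ≠ 0 := by
    refine Int.cast_ne_zero.2 ?_
    rintro rfl
    omega
  refine (splitBy_iff φ).2 (brauerTrivial_of_norm two_ne_zero ?_ p (q / (2 * m)) ha ?_)
  · rw [hd]
    exact mul_ne_zero (by norm_num) (pow_ne_zero 2 hm0)
  · rw [hd, h]
    field_simp
    ring

theorem not_splitBy_of_anisotropic {k m : ℤ} (hm : 4 * k + 1 = m ^ 2) (i : Fin 3) {K : Type}
    [Field K] [Algebra ℚ K] (φ : CoordRing k →+* K)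
    (h : ∀ X Y V W : K, φ (quadFun k i) * X ^ 2 - Y ^ 2 = 2 * (φ (quadFun k i) * W ^ 2 - V ^ 2) →
      X = 0 ∧ Y = 0 ∧ V = 0 ∧ W = 0) : ¬ SplitBy φ (quatClass k i).carrier := by
  have : CharZero K := algebraRat.charZero K
  have hd := disc_map_eq hm i φ
  have hm0 : (m : K) ≠ 0 := by
    refine Int.cast_ne_zero.2 ?_
    rintro rfl
    omega
  have ha : φ (quadFun k i) ≠ 0 := by
    intro ha
    exact one_ne_zero (h 1 0 0 0 (by rw [ha]; ring)).1
  refine fun hs => not_brauerTrivial_of_anisotropic ?_ ((splitBy_iff φ).1 hs)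
  intro x hx
  simp only [nrd] at hx
  -- Multiplying the reduced norm by `a = φ (quadFun k i)` and completing squares gives `a X² - Y² -
  -- 2 (a W² - V²)`, since a quarter of the discriminant is `2 m²`.
  obtain ⟨hX, hY, hV, hW⟩ := h (x.re + φ (polarFun k i) / 2 * x.cw)
    (φ (quadFun k i) * x.cu + φ (polarFun k i) / 2 * x.cv) (m * x.cv) (m * x.cw) (by
      linear_combination φ (quadFun k i) * hx + (φ (quadFun k i) * x.cw ^ 2 - x.cv ^ 2) / 4 * hd)
  have hv : x.cv = 0 := (mul_eq_zero.1 hV).resolve_left hm0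
  have hw : x.cw = 0 := (mul_eq_zero.1 hW).resolve_left hm0
  rw [hw, mul_zero, add_zero] at hX
  rw [hv, mul_zero, add_zero] at hY
  exact BinaryClifford.ext hX ((mul_eq_zero.1 hY).resolve_left ha) hv hw

theorem evalAt_quadFun {k : ℤ} {A : Type} [CommRing A] [Algebra ℚ A] (P : Points k A) (i : Fin 3) :
    (evalAt P).toRingHom (quadFun k i) = 4 * P.1 i ^ 2 + 1 := by
  have h : evalAt P (coord k i) = P.1 i :=
    MvPolynomial.aeval_X P.1 i
  change evalAt P (quadFun k i) = _
  rw [quadFun, map_add, map_mul, map_pow, h, map_one, map_ofNat (evalAt P) 4]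

/-! ### Hensel lifting and the invariants away from 2 -/

section padic

variable {p : ℕ} [Fact p.Prime]

theorem exists_sq_eq_of_norm_lt {c y : ℤ_[p]} (h : ‖y ^ 2 - c‖ < ‖2 * y‖ ^ 2) :
    ∃ z : ℤ_[p], z ^ 2 = c := by
  obtain ⟨z, hz, -⟩ := hensels_lemma (F := (Polynomial.X ^ 2 - Polynomial.C c : Polynomial ℤ_[p]))
    (a := y) (by simpa [one_add_one_eq_two] using h)
  exact ⟨z, by simpa [sub_eq_zero] using hz⟩

theorem toZMod_eq_zero_iff (x : ℤ_[p]) : PadicInt.toZMod x = 0 ↔ ‖x‖ < 1 := by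
  rw [← RingHom.mem_ker, PadicInt.ker_toZMod, PadicInt.maximalIdeal_eq_span_p,
    Ideal.mem_span_singleton, PadicInt.norm_lt_one_iff_dvd]

theorem norm_eq_one_of_toZMod_ne_zero {x : ℤ_[p]} (h : PadicInt.toZMod x ≠ 0) : ‖x‖ = 1 :=
  le_antisymm (PadicInt.norm_le_one x) (not_lt.1 (mt (toZMod_eq_zero_iff x).2 h))

theorem two_ne_zero_zmod (hp : p ≠ 2) : (2 : ZMod p) ≠ 0 := by
  intro h
  have h1 : ((2 : ℕ) : ZMod p) = 0 := by exact_mod_cast h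
  rw [ZMod.natCast_eq_zero_iff] at h1
  exact hp ((Nat.prime_dvd_prime_iff_eq Fact.out Nat.prime_two).1 h1)

theorem exists_sq_eq_of_toZMod (hp : p ≠ 2) {c y : ℤ_[p]} (hy : PadicInt.toZMod y ≠ 0)
    (h : PadicInt.toZMod y ^ 2 = PadicInt.toZMod c) : ∃ z : ℤ_[p], z ^ 2 = c := by
  refine exists_sq_eq_of_norm_lt (y := y) ?_
  have h2 : ‖2 * y‖ = 1 := by
    apply norm_eq_one_of_toZMod_ne_zero
    rw [map_mul, map_ofNat]
    exact mul_ne_zero (two_ne_zero_zmod hp) hy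
  rw [h2, one_pow, ← toZMod_eq_zero_iff, map_sub, map_pow, h, sub_self]

/-- For odd `p`, the form `x² + n y²` with `n` a unit represents all units of `ℤ_p`. -/
theorem exists_sq_add_mul_sq_eq (hp : p ≠ 2) {n c : ℤ_[p]} (hn : PadicInt.toZMod n ≠ 0)
    (hc : PadicInt.toZMod c ≠ 0) : ∃ x y : ℤ_[p], x ^ 2 + n * y ^ 2 = c := by
  obtain ⟨x₀, y₀, h⟩ := FiniteField.exists_root_sum_quadratic (R := ZMod p)
    (f := Polynomial.X ^ 2)
    (g := Polynomial.C (PadicInt.toZMod n) * Polynomial.X ^ 2 - Polynomial.C (PadicInt.toZMod c))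
    (by simp) (by
      rw [Polynomial.degree_sub_eq_left_of_degree_lt] <;>
      rw [Polynomial.degree_C_mul hn, Polynomial.degree_X_pow]
      · rfl
      · exact Polynomial.degree_C_le.trans_lt (by decide))
    (by rw [ZMod.card]; exact (Fact.out : p.Prime).eq_two_or_odd.resolve_left hp)
  simp only [Polynomial.eval_pow, Polynomial.eval_X, Polynomial.eval_sub, Polynomial.eval_mul,
    Polynomial.eval_C] at h
  obtain ⟨x, rfl⟩ := ZMod.ringHom_surjective (PadicInt.toZMod (p := p)) x₀
  obtain ⟨y, rfl⟩ := ZMod.ringHom_surjective (PadicInt.toZMod (p := p)) y₀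
  by_cases hx : PadicInt.toZMod x = 0
  · obtain ⟨n', hn'⟩ := (PadicInt.isUnit_iff.2 (norm_eq_one_of_toZMod_ne_zero hn)).exists_right_inv
    have hy : PadicInt.toZMod y ≠ 0 := by
      intro hy
      rw [hx, hy] at h
      apply hc
      linear_combination -h
    obtain ⟨z, hz⟩ := exists_sq_eq_of_toZMod hp (c := n' * (c - x ^ 2)) hy (by
      have h1 := congrArg (PadicInt.toZMod (p := p)) hn'
      simp only [map_mul, map_one, map_sub, map_pow] at h1 ⊢
      linear_combination PadicInt.toZMod n' * h - PadicInt.toZMod y ^ 2 * h1)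
    exact ⟨x, z, by linear_combination n * hz + (c - x ^ 2) * hn'⟩
  · obtain ⟨z, hz⟩ := exists_sq_eq_of_toZMod hp (c := c - n * y ^ 2) hx (by
      simp only [map_sub, map_mul, map_pow]
      linear_combination h)
    exact ⟨z, y, by linear_combination hz⟩

end padic

theorem F₃_norm_eq {A : Type} [CommRing A] {k m : ℤ} (hm : 4 * k + 1 = m ^ 2) (P : Points k A)
    (i : Fin 3) : (4 * P.1 i ^ 2 + 1) *
      ((4 * P.1 (i + 1) ^ 2 + 1) * (4 * P.1 (i + 2) ^ 2 + 1)) =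
      (m : A) ^ 2 + 2 * (8 * P.1 0 * P.1 1 * P.1 2) ^ 2 := by
  have hmA : 4 * (k : A) + 1 = (m : A) ^ 2 := by exact_mod_cast congrArg (Int.cast : ℤ → A) hm
  have h := P.2
  simp only [F₃] at h
  have h1 : (1 : Fin 3) + 2 = 0 := rfl
  have h2 : (2 : Fin 3) + 1 = 0 := rfl
  have h3 : (2 : Fin 3) + 2 = 1 := rfl
  have h4 : (1 : Fin 3) + 1 = 2 := rfl
  fin_cases i
  · simp only [Fin.zero_eta, zero_add]
    linear_combination 4 * h + hmA
  · simp only [Fin.mk_one, h1, h4]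
    linear_combination 4 * h + hmA
  · simp only [Fin.reduceFinMk, h2, h3]
    linear_combination 4 * h + hmA

/-- Away from the primes `p ≡ 1 mod 8`, the function `4 xᵢ² + 1` has no zeros modulo `p`. -/
theorem quad_ne_zero_of_mod_eight_ne_one {p : ℕ} [Fact p.Prime] {k m : ℤ}
    (hm : 4 * k + 1 = m ^ 2) (hpm : p % 8 = 5 → ¬ (p : ℤ) ∣ m) (hp : p ≠ 2) (hp8 : p % 8 ≠ 1)
    (P : Points k (ZMod p)) (i : Fin 3) : 4 * P.1 i ^ 2 + 1 ≠ 0 := by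
  intro h
  have hsq : IsSquare (-1 : ZMod p) := ⟨2 * P.1 i, by linear_combination -h⟩
  have h4 := ZMod.exists_sq_eq_neg_one_iff.1 hsq
  have hodd := (Fact.out : p.Prime).eq_two_or_odd.resolve_left hp
  have h5 : p % 8 = 5 := by omega
  have hm0 : (m : ZMod p) ≠ 0 := by
    rw [Ne, ZMod.intCast_zmod_eq_zero_iff_dvd]
    exact hpm h5
  have h1 := F₃_norm_eq hm P i
  rw [h, zero_mul] at h1
  generalize 8 * P.1 0 * P.1 1 * P.1 2 = w at h1
  have hw : w ≠ 0 := by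
    rintro rfl
    apply hm0
    apply pow_eq_zero_iff two_ne_zero |>.1
    linear_combination -h1
  have h2 : IsSquare (-2 : ZMod p) := ⟨m / w, by field_simp; linear_combination h1⟩
  have h3 := (ZMod.exists_sq_eq_neg_two_iff hp).1 h2
  omega

theorem evalAt_padic {k : ℤ} {p : ℕ} [Fact p.Prime] (P : Points k ℤ_[p]) (i : Fin 3) :
    (evalAt (P.map (PadicInt.Coe.ringHom (p := p)))).toRingHom (quadFun k i) =
      ((4 * P.1 i ^ 2 + 1 : ℤ_[p]) : ℚ_[p]) := by
  rw [evalAt_quadFun]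
  push_cast
  rfl

theorem padicInv_eq_zero_of_ne_two {k m : ℤ} (hm : 4 * k + 1 = m ^ 2) {p : ℕ} [Fact p.Prime]
    (hpm : p % 8 = 5 → ¬ (p : ℤ) ∣ m) (hp : p ≠ 2) (P : Points k ℤ_[p]) (i : Fin 3) :
    padicInv (quatClass k i) p P = 0 := by
  refine if_pos ?_
  have h2 := two_ne_zero_zmod hp
  by_cases hp8 : p % 8 = 1 ∨ p % 8 = 7
  · obtain ⟨x, hx⟩ := (ZMod.exists_sq_eq_two_iff hp).2 hp8
    obtain ⟨y, rfl⟩ := ZMod.ringHom_surjective (PadicInt.toZMod (p := p)) x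
    obtain ⟨z, hz⟩ := exists_sq_eq_of_toZMod hp (c := 2) (y := y)
      (by intro h; rw [h, mul_zero] at hx; exact h2 hx) (by rw [map_ofNat, hx, sq])
    exact splitBy_of_two_eq_sq hm i _ (z : ℚ_[p]) (by exact_mod_cast congrArg Subtype.val hz)
  · have ha : PadicInt.toZMod (4 * P.1 i ^ 2 + 1) ≠ 0 := by
      have h := quad_ne_zero_of_mod_eight_ne_one hm hpm hp (by omega)
        (P.map (PadicInt.toZMod (p := p))) i
      rw [map_add, map_mul, map_pow, map_one, map_ofNat]
      exact h
    obtain ⟨x, y, hxy⟩ := exists_sq_add_mul_sq_eq hp (n := -2)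
      (by rw [map_neg, map_ofNat]; exact neg_ne_zero.2 h2) ha
    refine splitBy_of_norm hm i _ (x : ℚ_[p]) y ?_ ?_
    · rw [evalAt_padic]
      intro h
      apply ha
      rw [PadicInt.coe_eq_zero] at h
      rw [h, map_zero]
    · rw [evalAt_padic, ← hxy]
      push_cast
      have h2' : ((2 : ℤ_[p]) : ℚ_[p]) = 2 := rfl
      rw [h2']
      ring

theorem realInv_eq_zero {k m : ℤ} (hm : 4 * k + 1 = m ^ 2) (P : Points k ℝ) (i : Fin 3) :
    realInv (quatClass k i) P = 0 :=
  if_pos (splitBy_of_two_eq_sq hm i _ √2 (Real.sq_sqrt zero_le_two))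

/-! ### The invariants at 2 -/

/-- Reduction `ℤ₂ → ℤ/8`. -/
def toZModEight : ℤ_[2] →+* ZMod 8 := PadicInt.toZModPow (p := 2) 3

theorem toZModEight_eq_zero_iff (x : ℤ_[2]) : toZModEight x = 0 ↔ 8 ∣ x := by
  have h : (8 : ℤ_[2]) = (2 : ℕ) ^ 3 := by norm_num
  rw [h, ← Ideal.mem_span_singleton, ← PadicInt.ker_toZModPow]
  rfl

/-- Expresses parity through the residue mod 8, so that the congruence arguments become finite
checks. -/
theorem two_dvd_iff (x : ℤ_[2]) : 2 ∣ x ↔ 4 * toZModEight x = 0 := by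
  have h : (4 : ZMod 8) * toZModEight x = toZModEight (4 * x) := by
    rw [map_mul, map_ofNat]
  rw [h, toZModEight_eq_zero_iff]
  have h4 : (4 : ℤ_[2]) ≠ 0 := OfNat.ofNat_ne_zero 4
  rw [show (8 : ℤ_[2]) = 4 * 2 by norm_num]
  exact (mul_dvd_mul_iff_left h4).symm

theorem exists_sq_eq_of_toZModEight_eq_one {c : ℤ_[2]} (h : toZModEight c = 1) :
    ∃ z : ℤ_[2], z ^ 2 = c := by
  refine exists_sq_eq_of_norm_lt (y := 1) ?_
  have h1 : 8 ∣ 1 ^ 2 - c := by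
    rw [← toZModEight_eq_zero_iff, map_sub, h, one_pow, map_one, sub_self]
  obtain ⟨d, hd⟩ := h1
  have h2 : ‖(2 : ℤ_[2])‖ = 2⁻¹ := by
    exact_mod_cast PadicInt.norm_p (p := 2)
  rw [hd, show (8 : ℤ_[2]) = 2 ^ 3 by norm_num, mul_one, norm_mul, norm_pow, h2]
  have h3 := PadicInt.norm_le_one d
  norm_num
  linarith

section anisotropic

variable {a : ℤ_[2]}

/-- `X` and `Y` have equal parity. If both were odd, the left side would be 4 mod 8 and `5 W² - V²`
would be 2 mod 4, which is impossible. -/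
theorem two_dvd_of_norm_eq (ha : toZModEight a = 5) {X Y V W : ℤ_[2]}
    (h : a * X ^ 2 - Y ^ 2 = 2 * (a * W ^ 2 - V ^ 2)) : 2 ∣ X ∧ 2 ∣ Y := by
  have h1 : ∀ V W : ZMod 8, 2 * (5 * W ^ 2 - V ^ 2) ≠ 4 := by decide
  have h2 : ∀ X Y T : ZMod 8, 5 * X ^ 2 - Y ^ 2 = 2 * T → 2 * T ≠ 4 → 4 * X = 0 ∧ 4 * Y = 0 := by
    decide
  have h3 := congrArg toZModEight h
  simp only [map_sub, map_mul, map_pow, map_ofNat, ha] at h3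
  rw [two_dvd_iff, two_dvd_iff]
  exact h2 _ _ _ h3 (h1 _ _)

/-- Infinite descent: halving `X` and `Y` gives the same equation with the pairs `(X, Y)` and `(W,
V)` exchanged. -/
theorem two_pow_dvd_of_norm_eq (ha : toZModEight a = 5) (n : ℕ) : ∀ X Y V W : ℤ_[2],
    a * X ^ 2 - Y ^ 2 = 2 * (a * W ^ 2 - V ^ 2) → 2 ^ n ∣ X ∧ 2 ^ n ∣ Y ∧ 2 ^ n ∣ V ∧ 2 ^ n ∣ W := by
  induction n with
  | zero => simp
  | succ n ih =>
    intro X Y V W h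
    obtain ⟨⟨X, rfl⟩, Y, rfl⟩ := two_dvd_of_norm_eq ha h
    have h1 : a * W ^ 2 - V ^ 2 = 2 * (a * X ^ 2 - Y ^ 2) := by
      refine mul_left_cancel₀ (two_ne_zero (α := ℤ_[2])) ?_
      linear_combination -h
    obtain ⟨⟨W, rfl⟩, V, rfl⟩ := two_dvd_of_norm_eq ha h1
    have h2 : a * X ^ 2 - Y ^ 2 = 2 * (a * W ^ 2 - V ^ 2) := by
      refine mul_left_cancel₀ (two_ne_zero (α := ℤ_[2])) ?_
      linear_combination -h1
    obtain ⟨hX, hY, hV, hW⟩ := ih X Y V W h2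
    simp only [pow_succ']
    exact ⟨mul_dvd_mul_left 2 hX, mul_dvd_mul_left 2 hY, mul_dvd_mul_left 2 hV,
      mul_dvd_mul_left 2 hW⟩

theorem eq_zero_of_two_pow_dvd {x : ℤ_[2]} (h : ∀ n : ℕ, 2 ^ n ∣ x) : x = 0 := by
  by_contra hx
  refine FiniteMultiplicity.not_iff_forall.2 h (FiniteMultiplicity.of_prime_left ?_ hx)
  exact_mod_cast PadicInt.prime_p (p := 2)

theorem exists_two_pow_mul_mem (x : ℚ_[2]) : ∃ n : ℕ, ∀ N ≥ n, ∃ y : ℤ_[2], 2 ^ N * x = y := by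
  have h2 : ‖(2 : ℚ_[2])‖ = 2⁻¹ := by
    exact_mod_cast Padic.norm_p (p := 2)
  obtain ⟨n, hn⟩ := pow_unbounded_of_one_lt ‖x‖ one_lt_two
  refine ⟨n, fun N hN => ⟨⟨2 ^ N * x, ?_⟩, rfl⟩⟩
  rw [norm_mul, norm_pow, h2, inv_pow, inv_mul_le_one₀ (by positivity)]
  exact hn.le.trans (pow_le_pow_right₀ one_le_two hN)

/-- For `a ≡ 5 mod 8`, the norm form of the quaternion algebra `(a, 2)` over `ℚ₂` is anisotropic. -/
theorem anisotropic_of_toZModEight_eq_five (ha : toZModEight a = 5) (X Y V W : ℚ_[2])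
    (h : (a : ℚ_[2]) * X ^ 2 - Y ^ 2 = 2 * (a * W ^ 2 - V ^ 2)) :
    X = 0 ∧ Y = 0 ∧ V = 0 ∧ W = 0 := by
  obtain ⟨n₁, h₁⟩ := exists_two_pow_mul_mem X
  obtain ⟨n₂, h₂⟩ := exists_two_pow_mul_mem Y
  obtain ⟨n₃, h₃⟩ := exists_two_pow_mul_mem V
  obtain ⟨n₄, h₄⟩ := exists_two_pow_mul_mem W
  obtain ⟨x, hx⟩ := h₁ (n₁ + n₂ + n₃ + n₄) (by omega)
  obtain ⟨y, hy⟩ := h₂ (n₁ + n₂ + n₃ + n₄) (by omega)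
  obtain ⟨v, hv⟩ := h₃ (n₁ + n₂ + n₃ + n₄) (by omega)
  obtain ⟨w, hw⟩ := h₄ (n₁ + n₂ + n₃ + n₄) (by omega)
  generalize n₁ + n₂ + n₃ + n₄ = N at hx hy hv hw
  have h2 : ((2 : ℤ_[2]) : ℚ_[2]) = 2 := rfl
  have h5 : a * x ^ 2 - y ^ 2 = 2 * (a * w ^ 2 - v ^ 2) := by
    apply Subtype.coe_injective
    push_cast
    rw [← hx, ← hy, ← hv, ← hw, h2]
    linear_combination (2 ^ N) ^ 2 * h
  have h6 := fun n => two_pow_dvd_of_norm_eq ha n x y v w h5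
  have hx0 : x = 0 := eq_zero_of_two_pow_dvd fun n => (h6 n).1
  have hy0 : y = 0 := eq_zero_of_two_pow_dvd fun n => (h6 n).2.1
  have hv0 : v = 0 := eq_zero_of_two_pow_dvd fun n => (h6 n).2.2.1
  have hw0 : w = 0 := eq_zero_of_two_pow_dvd fun n => (h6 n).2.2.2
  subst hx0 hy0 hv0 hw0
  simpa using And.intro hx (And.intro hy (And.intro hv hw))

end anisotropic

theorem half_ne_zero_addCircle : ((1 / 2 : ℚ) : AddCircle (1 : ℚ)) ≠ 0 := by
  rw [Ne, AddCircle.coe_eq_zero_iff]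
  rintro ⟨n, hn⟩
  have h1 : (n : ℚ) * 2 = 1 := by
    rw [zsmul_one] at hn
    rw [hn]
    norm_num
  have h2 : n * 2 = 1 := by exact_mod_cast h1
  omega

theorem padicInv_two_eq_zero_iff {k m : ℤ} (hm : 4 * k + 1 = m ^ 2) (P : Points k ℤ_[2])
    (i : Fin 3) : padicInv (quatClass k i) 2 P = 0 ↔ 2 ∣ P.1 i := by
  constructor
  · intro h
    by_contra hodd
    refine half_ne_zero_addCircle ?_
    rw [← h]
    refine (if_neg (not_splitBy_of_anisotropic hm i _ ?_)).symm
    rw [evalAt_padic]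
    refine anisotropic_of_toZModEight_eq_five ?_
    rw [two_dvd_iff] at hodd
    rw [map_add, map_mul, map_pow, map_ofNat, map_one]
    revert hodd
    generalize toZModEight (P.1 i) = x
    revert x
    decide
  · rintro ⟨y, hy⟩
    have h1 : toZModEight (4 * P.1 i ^ 2 + 1) = 1 := by
      rw [hy, map_add, map_mul, map_pow, map_mul, map_ofNat, map_ofNat, map_one]
      generalize toZModEight y = x
      revert x
      decide
    obtain ⟨z, hz⟩ := exists_sq_eq_of_toZModEight_eq_one h1
    refine if_pos (splitBy_of_norm hm i _ (z : ℚ_[2]) 0 ?_ ?_)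
    · rw [evalAt_padic]
      intro h
      rw [PadicInt.coe_eq_zero] at h
      rw [h, map_zero] at h1
      exact absurd h1 (by decide)
    · rw [evalAt_padic, ← hz]
      push_cast
      ring

/-- If `x` and `y` were even, the mixed terms would vanish mod 8, leaving `z² ≡ 2` or `6`. -/
theorem not_two_dvd_of_toZModEight_eq_six {k : ℤ} (hk : (k : ZMod 8) = 6) (P : Points k ℤ_[2]) :
    ¬ 2 ∣ P.1 0 ∨ ¬ 2 ∣ P.1 1 := by
  have h := (P.map toZModEight).2.trans hk
  have key : ∀ x y z : ZMod 8, F₃ x y z = 6 → ¬ 4 * x = 0 ∨ ¬ 4 * y = 0 := by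
    unfold F₃
    decide
  rw [two_dvd_iff, two_dvd_iff]
  exact key _ _ _ h

/-- Already mod 4 the equation is `x² + y² + z² ≡ 0`. -/
theorem two_dvd_of_toZModEight_eq_four {k : ℤ} (hk : (k : ZMod 8) = 4) (P : Points k ℤ_[2]) :
    2 ∣ P.1 0 ∧ 2 ∣ P.1 1 ∧ 2 ∣ P.1 2 := by
  have h := (P.map toZModEight).2.trans hk
  have key : ∀ x y z : ZMod 8, F₃ x y z = 4 → 4 * x = 0 ∧ 4 * y = 0 ∧ 4 * z = 0 := by
    unfold F₃
    decide
  rw [two_dvd_iff, two_dvd_iff, two_dvd_iff]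
  exact key _ _ _ h

theorem isEmpty_points_two {k K : ℤ} (hkK : k = 4 * K) (hK : K % 8 = 7) :
    IsEmpty (Points k ℤ_[2]) := by
  refine ⟨fun P => ?_⟩
  have hk : (k : ZMod 8) = 4 := by
    have h : ((k - 4 : ℤ) : ZMod 8) = 0 := (ZMod.intCast_zmod_eq_zero_iff_dvd _ 8).2 (by omega)
    push_cast at h
    linear_combination h
  obtain ⟨⟨x, hx⟩, ⟨y, hy⟩, ⟨z, hz⟩⟩ := two_dvd_of_toZModEight_eq_four hk P
  have h := P.2
  rw [hx, hy, hz, hkK] at h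
  push_cast at h
  have h1 : x ^ 2 + y ^ 2 + z ^ 2 + 16 * (x ^ 2 * y ^ 2 + y ^ 2 * z ^ 2 + z ^ 2 * x ^ 2)
      - 256 * (x ^ 2 * y ^ 2 * z ^ 2) = K := by
    refine mul_left_cancel₀ (OfNat.ofNat_ne_zero (R := ℤ_[2]) 4) ?_
    simp only [F₃] at h
    linear_combination h
  have hK8 : (K : ZMod 8) = 7 := by
    have h : ((K - 7 : ℤ) : ZMod 8) = 0 := (ZMod.intCast_zmod_eq_zero_iff_dvd _ 8).2 (by omega)
    push_cast at h
    linear_combination h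
  have h2 := congrArg toZModEight h1
  simp only [map_add, map_sub, map_mul, map_pow, map_ofNat, map_intCast, hK8] at h2
  have h16 : (16 : ZMod 8) = 0 := rfl
  have h256 : (256 : ZMod 8) = 0 := rfl
  rw [h16, h256, zero_mul, zero_mul, add_zero, sub_zero] at h2
  have key : ∀ x y z : ZMod 8, x ^ 2 + y ^ 2 + z ^ 2 ≠ 7 := by decide
  exact key _ _ _ h2

/-! ### Existence of local points -/

theorem nonempty_points_real {k : ℤ} (hk : 0 ≤ k) : Nonempty (Points k ℝ) := by
  have h : (0 : ℝ) ≤ k := by exact_mod_cast hk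
  exact ⟨⟨![√k, 0, 0], by simp [F₃, Real.sq_sqrt h]⟩⟩

/-- For `z = 1/2` the quartic and sextic terms in `x² y²` cancel, leaving `x² + y² = (4k-1)/8`,
which is solvable when `4k - 1` is a unit. Otherwise `k ≡ 1/4 mod p` is a square and `(√k, 0, 0)` is
a point. -/
theorem nonempty_points_padic (k : ℤ) {p : ℕ} [Fact p.Prime] (hp : p ≠ 2) :
    Nonempty (Points k ℤ_[p]) := by
  have h2 := two_ne_zero_zmod hp
  obtain ⟨h, hh⟩ := (PadicInt.isUnit_iff.2 (norm_eq_one_of_toZMod_ne_zero (x := (2 : ℤ_[p]))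
    (by rwa [map_ofNat]))).exists_right_inv
  have hh' := congrArg (PadicInt.toZMod (p := p)) hh
  rw [map_mul, map_ofNat, map_one] at hh'
  have h0 : PadicInt.toZMod h ≠ 0 := right_ne_zero_of_mul_eq_one hh'
  by_cases hk : PadicInt.toZMod (4 * (k : ℤ_[p]) - 1) = 0
  · obtain ⟨x, hx⟩ := exists_sq_eq_of_toZMod hp (c := (k : ℤ_[p])) h0 (by
      rw [map_sub, map_mul, map_ofNat, map_one] at hk
      linear_combination -PadicInt.toZMod h ^ 2 * hk +
        PadicInt.toZMod (k : ℤ_[p]) * (2 * PadicInt.toZMod h + 1) * hh')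
    exact ⟨⟨![x, 0, 0], by simp [F₃, hx]⟩⟩
  · obtain ⟨x, y, hxy⟩ := exists_sq_add_mul_sq_eq hp (n := 1)
      (c := (4 * (k : ℤ_[p]) - 1) * h ^ 3) (by rw [map_one]; exact one_ne_zero)
      (by rw [map_mul, map_pow]; exact mul_ne_zero hk (pow_ne_zero 3 h0))
    refine ⟨⟨![x, y, h], ?_⟩⟩
    have h4 : 4 * h ^ 2 = 1 := by linear_combination (2 * h + 1) * hh
    simp only [F₃, Matrix.cons_val]
    linear_combination 2 * hxy + (x ^ 2 + y ^ 2 - 4 * x ^ 2 * y ^ 2) * h4 +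
      (4 * (k : ℤ_[p]) - 1) * h ^ 2 * hh + k * h4

theorem isUnit_intCast_padicInt_two {n : ℤ} (hn : n % 2 = 1) : IsUnit (n : ℤ_[2]) := by
  refine PadicInt.isUnit_iff.2 (le_antisymm (PadicInt.norm_le_one _) (not_lt.1 fun h => ?_))
  have := PadicInt.norm_intCast_lt_one_iff.1 h
  omega

theorem toZModEight_intCast_eq {n r : ℤ} (h : n % 8 = r % 8) :
    toZModEight (n : ℤ_[2]) = (r : ZMod 8) := by
  rw [map_intCast]
  exact (ZMod.intCast_eq_intCast_iff n r 8).2 h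

/-- A linear equation `n x² = c` with `n ≡ c mod 8` odd has a solution in `ℤ₂`. -/
theorem exists_mul_sq_eq {n c : ℤ} (hn : n % 2 = 1) (h : n % 8 = c % 8) :
    ∃ x : ℤ_[2], (n : ℤ_[2]) * x ^ 2 = c := by
  obtain ⟨n', hn'⟩ := (isUnit_intCast_padicInt_two hn).exists_right_inv
  obtain ⟨x, hx⟩ := exists_sq_eq_of_toZModEight_eq_one (c := n' * c) (by
    rw [map_mul, toZModEight_intCast_eq h.symm, mul_comm, ← map_one toZModEight, ← hn', map_mul,
      map_intCast])
  exact ⟨x, by rw [hx, ← mul_assoc, hn', one_mul]⟩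

theorem nonempty_points_two_of_mod_eight_eq_six {k : ℤ} (hk : k % 8 = 6) :
    Nonempty (Points k ℤ_[2]) := by
  obtain ⟨y, hy⟩ := exists_mul_sq_eq (n := 5) (c := k - 1) (by norm_num) (by omega)
  refine ⟨⟨![1, y, 0], ?_⟩⟩
  push_cast at hy
  simp only [F₃, Matrix.cons_val]
  linear_combination hy

/-- After division by 4 the points follow `1 = 1+0+0`, `5 = 1+4+0`, `3 = 1+1+1` mod 8. The
coefficients 65 and -223 of `x²` are 1 mod 8. -/
theorem nonempty_points_two {k K : ℤ} (hkK : k = 4 * K) (hK : K % 2 = 1) (hK7 : K % 8 ≠ 7) :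
    Nonempty (Points k ℤ_[2]) := by
  have h : K % 8 = 1 ∨ K % 8 = 5 ∨ K % 8 = 3 := by omega
  subst hkK
  rcases h with h | h | h
  · obtain ⟨x, hx⟩ := exists_mul_sq_eq (n := 1) (c := K) (by norm_num) (by omega)
    refine ⟨⟨![2 * x, 0, 0], ?_⟩⟩
    push_cast at hx ⊢
    simp only [F₃]
    linear_combination 4 * hx
  · obtain ⟨x, hx⟩ := exists_mul_sq_eq (n := 65) (c := K - 4) (by norm_num) (by omega)
    refine ⟨⟨![2 * x, 4, 0], ?_⟩⟩
    push_cast at hx ⊢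
    simp only [F₃]
    linear_combination 4 * hx
  · obtain ⟨x, hx⟩ := exists_mul_sq_eq (n := -223) (c := K - 18) (by norm_num) (by omega)
    refine ⟨⟨![2 * x, 2, 2], ?_⟩⟩
    push_cast at hx ⊢
    simp only [F₃]
    linear_combination 4 * hx

theorem nonempty_adelicPoints {k : ℤ} (hk : 0 ≤ k) (h2 : Nonempty (Points k ℤ_[2])) :
    Nonempty (AdelicPoints k) := by
  have h : ∀ p : Nat.Primes, Nonempty (Points k ℤ_[(p : ℕ)]) := by
    rintro ⟨p, hp⟩
    have : Fact p.Prime := ⟨hp⟩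
    by_cases hp2 : p = 2
    · subst hp2
      exact h2
    · exact nonempty_points_padic k hp2
  exact ⟨(nonempty_points_real hk).some, fun p => (h p).some⟩

/-! ### Integral points and the Brauer–Manin pairing -/

theorem mod_eight_eq_one_of_prime_dvd (n : ℕ) (hn : n ≠ 0)
    (h : ∀ p : ℕ, p.Prime → p ∣ n → p % 8 = 1) : n % 8 = 1 := by
  induction n using Nat.recOnMul with
  | zero => exact absurd rfl hn
  | one => rfl
  | prime p hp => exact h p hp dvd_rfl
  | mul a b ha hb =>
    have h1 := ha (left_ne_zero_of_mul hn) fun p hp hpa => h p hp (hpa.mul_right b)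
    have h2 := hb (right_ne_zero_of_mul hn) fun p hp hpb => h p hp (hpb.mul_left a)
    rw [Nat.mul_mod, h1, h2]

/-- The coordinates of an integral point are even, because all prime factors of `4 xᵢ² + 1` are
congruent to `1` modulo `8`. -/
theorem two_dvd_of_integral {k m : ℤ} (hm : 4 * k + 1 = m ^ 2)
    (hpm : ∀ p : ℕ, p.Prime → p % 8 = 5 → ¬ (p : ℤ) ∣ m) (P : Points k ℤ) (i : Fin 3) :
    2 ∣ P.1 i := by
  have h := mod_eight_eq_one_of_prime_dvd (4 * (P.1 i).natAbs ^ 2 + 1) (by omega) (by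
    intro p hp hpd
    by_contra hp8
    have : Fact p.Prime := ⟨hp⟩
    have hp2 : p ≠ 2 := by
      rintro rfl
      omega
    refine quad_ne_zero_of_mod_eight_ne_one hm (hpm p hp) hp2 hp8
      (P.map (Int.castRingHom (ZMod p))) i ?_
    have h1 : (p : ℤ) ∣ 4 * P.1 i ^ 2 + 1 := by
      have h2 : (p : ℤ) ∣ ((4 * (P.1 i).natAbs ^ 2 + 1 : ℕ) : ℤ) := Int.natCast_dvd_natCast.2 hpd
      push_cast at h2
      rwa [sq_abs] at h2
    have h3 := (ZMod.intCast_zmod_eq_zero_iff_dvd _ p).2 h1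
    push_cast at h3
    exact h3)
  by_contra hodd
  have h1 : (P.1 i).natAbs % 2 = 1 := by omega
  obtain ⟨t, ht⟩ : ∃ t, (P.1 i).natAbs = 2 * t + 1 := ⟨(P.1 i).natAbs / 2, by omega⟩
  rw [ht] at h
  ring_nf at h
  omega

theorem pairing_eq_padicInv_two {k m : ℤ} (hm : 4 * k + 1 = m ^ 2)
    (hpm : ∀ p : ℕ, p.Prime → p % 8 = 5 → ¬ (p : ℤ) ∣ m) (P : AdelicPoints k) (i : Fin 3) :
    pairing (quatClass k i) P = padicInv (quatClass k i) 2 (P.2 ⟨2, Nat.prime_two⟩) := by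
  rw [pairing, realInv_eq_zero hm, zero_add]
  refine finsum_eq_single _ (⟨2, Nat.prime_two⟩ : Nat.Primes) fun p hp => ?_
  have : Fact (p : ℕ).Prime := ⟨p.2⟩
  exact padicInv_eq_zero_of_ne_two hm (hpm p p.2) (fun h => hp (Subtype.ext h)) _ _

end MarkoffK3

end

theorem mainTheorem12 (k ℓ : ℤ) (hk : k = ℓ * (ℓ + 1))
    (h27 : ℓ ≡ 4 [ZMOD 27]) (h35 : ℓ ≡ 1 [ZMOD 35])
    (h37 : ¬ ℓ ≡ 0 [ZMOD 37]) (h37' : ¬ ℓ ≡ -1 [ZMOD 37])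
    (hp : ∀ p : ℕ, p.Prime → (p : ℤ) ∣ 2 * ℓ + 1 →
      (p : ℤ) ≡ 1 [ZMOD 8] ∨ (p : ℤ) ≡ -1 [ZMOD 8] ∨ (p : ℤ) ≡ 3 [ZMOD 8])
    (h8 : ℓ ≡ 5 [ZMOD 8] ∨ ℓ ≡ 3 [ZMOD 8]) :
    ∃ 𝒜₁ 𝒜₂ : MarkoffK3.AzumayaAlgebra (MarkoffK3.CoordRing k),
      -- the classes `(4x²+1, 2(4k+1))` and `(4y²+1, 2(4k+1))` in the algebraic Brauer group
      (MarkoffK3.RepresentsQuaternionClass k 0 𝒜₁ ∧ MarkoffK3.IsAlgebraic k 𝒜₁ ∧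
        MarkoffK3.IsTwoTorsion 𝒜₁) ∧
      (MarkoffK3.RepresentsQuaternionClass k 1 𝒜₂ ∧ MarkoffK3.IsAlgebraic k 𝒜₂ ∧
        MarkoffK3.IsTwoTorsion 𝒜₂) ∧
      -- all local invariants at places other than `2` vanish
      (∀ P : MarkoffK3.Points k ℝ, MarkoffK3.realInv 𝒜₁ P = 0 ∧ MarkoffK3.realInv 𝒜₂ P = 0) ∧
      (∀ (p : ℕ) [Fact p.Prime], p ≠ 2 → ∀ P : MarkoffK3.Points k ℤ_[p],
        MarkoffK3.padicInv 𝒜₁ p P = 0 ∧ MarkoffK3.padicInv 𝒜₂ p P = 0) ∧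
      -- the obstruction for `ℓ ≡ 5 mod 8`
      (ℓ ≡ 5 [ZMOD 8] →
        Nonempty (MarkoffK3.AdelicPoints k) ∧
        MarkoffK3.brauerManinSet k {𝒜₁, 𝒜₂} = ∅ ∧
        IsEmpty (MarkoffK3.Points k ℤ) ∧
        ∀ P : MarkoffK3.Points k ℤ_[2],
          MarkoffK3.padicInv 𝒜₁ 2 P ≠ 0 ∨ MarkoffK3.padicInv 𝒜₂ 2 P ≠ 0) ∧
      -- no obstruction for `ℓ ≡ 3 mod 8`
      (ℓ ≡ 3 [ZMOD 8] →
        MarkoffK3.brauerManinSet k {𝒜₁, 𝒜₂} = Set.univ ∧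
        ((MarkoffK3.brauerManinSet k {𝒜₁, 𝒜₂}).Nonempty ↔ ¬ ℓ ≡ 19 [ZMOD 32])) := by
  open MarkoffK3 in
  have hm : 4 * k + 1 = (2 * ℓ + 1) ^ 2 := by rw [hk]; ring
  have hpm : ∀ p : ℕ, p.Prime → p % 8 = 5 → ¬ (p : ℤ) ∣ 2 * ℓ + 1 := by
    intro p hpp h5 hd
    have h := hp p hpp hd
    simp only [Int.ModEq] at h
    omega
  have hk0 : 0 ≤ k := by
    rw [hk]
    rcases le_or_gt 0 ℓ with h | h
    · positivity
    · exact mul_nonneg_of_nonpos_of_nonpos (by omega) (by omega)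
  refine ⟨quatClass k 0, quatClass k 1,
    ⟨representsQuaternionClass_quatClass k 0, isAlgebraic_quatClass hm 0,
      isTwoTorsion_quatClass k 0⟩,
    ⟨representsQuaternionClass_quatClass k 1, isAlgebraic_quatClass hm 1,
      isTwoTorsion_quatClass k 1⟩,
    fun P => ⟨realInv_eq_zero hm P 0, realInv_eq_zero hm P 1⟩, ?_, ?_, ?_⟩
  · intro p _ hp2 P
    have h := hpm p Fact.out
    exact ⟨padicInv_eq_zero_of_ne_two hm h hp2 P 0, padicInv_eq_zero_of_ne_two hm h hp2 P 1⟩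
  · intro h5
    obtain ⟨s, hs⟩ : ∃ s, ℓ = 8 * s + 5 := ⟨ℓ / 8, by simp only [Int.ModEq] at h5; omega⟩
    have hk6 : k % 8 = 6 := by
      have h : k = 8 * (8 * s ^ 2 + 11 * s + 3) + 6 := by rw [hk, hs]; ring
      omega
    have hkZ : (k : ZMod 8) = 6 := (ZMod.intCast_eq_intCast_iff k 6 8).2 hk6
    have hne : ∀ P : Points k ℤ_[2],
        padicInv (quatClass k 0) 2 P ≠ 0 ∨ padicInv (quatClass k 1) 2 P ≠ 0 := by
      intro P
      rw [Ne, Ne, padicInv_two_eq_zero_iff hm, padicInv_two_eq_zero_iff hm]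
      exact not_two_dvd_of_toZModEight_eq_six hkZ P
    refine ⟨nonempty_adelicPoints hk0 (nonempty_points_two_of_mod_eight_eq_six hk6), ?_, ⟨?_⟩, hne⟩
    · refine Set.eq_empty_of_forall_notMem fun P hP => ?_
      have h0 := hP (quatClass k 0) (Set.mem_insert _ _)
      have h1 := hP (quatClass k 1) (Set.mem_insert_of_mem _ rfl)
      rw [pairing_eq_padicInv_two hm hpm] at h0 h1
      exact (hne _).elim (fun h => h h0) fun h => h h1
    -- The obstruction for integral points in elementary form: all coordinates are even, against `k
    -- ≡ 6 mod 8`.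
    · intro P
      have hdvd : ∀ i, (2 : ℤ_[2]) ∣ (P.map (Int.castRingHom ℤ_[2])).1 i := fun i => by
        have h := map_dvd (Int.castRingHom ℤ_[2]) (two_dvd_of_integral hm hpm P i)
        rwa [map_ofNat] at h
      exact (not_two_dvd_of_toZModEight_eq_six hkZ (P.map (Int.castRingHom ℤ_[2]))).elim
        (fun h => h (hdvd 0)) fun h => h (hdvd 1)
  · intro h3
    obtain ⟨s, hs⟩ : ∃ s, ℓ = 8 * s + 3 := ⟨ℓ / 8, by simp only [Int.ModEq] at h3; omega⟩
    have hkK : k = 4 * (16 * s ^ 2 + 14 * s + 3) := by rw [hk, hs]; ring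
    have hkZ : (k : ZMod 8) = 4 := (ZMod.intCast_eq_intCast_iff k 4 8).2 (by
      have h : k = 8 * (8 * s ^ 2 + 7 * s + 1) + 4 := by rw [hkK]; ring
      simp only [Int.ModEq]
      omega)
    have huniv : brauerManinSet k {quatClass k 0, quatClass k 1} = Set.univ := by
      refine Set.eq_univ_of_forall fun P => ?_
      have h := two_dvd_of_toZModEight_eq_four hkZ (P.2 ⟨2, Nat.prime_two⟩)
      rintro 𝒜 (rfl | rfl) <;> rw [pairing_eq_padicInv_two hm hpm]
      · exact (padicInv_two_eq_zero_iff hm _ 0).2 h.1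
      · exact (padicInv_two_eq_zero_iff hm _ 1).2 h.2.1
    refine ⟨huniv, ?_⟩
    rw [huniv, ← Set.nonempty_iff_univ_nonempty]
    constructor
    -- `k/4 ≡ 6s + 3 mod 8` equals 7 exactly when `s ≡ 2 mod 4`, that is, `ℓ = 8s + 3 ≡ 19 mod 32`.
    · rintro ⟨P⟩ h19
      refine (isEmpty_points_two hkK ?_).false (P.2 ⟨2, Nat.prime_two⟩)
      simp only [Int.ModEq] at h19
      omega
    · intro h19
      refine nonempty_adelicPoints hk0 (nonempty_points_two hkK (by omega) ?_)
      simp only [Int.ModEq] at h19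
      omega
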